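/- Notation. Let $1\le k\le d$ be integers, $p\ge 1$ real, and $\|\cdot\|$ the Euclidean norm. For Borel probability measures $\mu,\nu$ on $\mathbb{R}^m$ let $$\mathcal{W}_p(\mu,\nu)=\Big(\inf_{\pi\in\Pi(\mu,\nu)}\int\|x-y\|^p\,d\pi(x,y)\Big)^{1/p}\in[0,\infty],$$ where $\Pi(\mu,\nu)$ is the set of couplings of $\mu$ and $\nu$. Let $\mathbb{S}_{d,k}=\{E\in\mathbb{R}^{d\times k}:E^\top E=I_k\}$, let $\sigma$ be the uniform distribution on $\mathbb{S}_{d,k}$ (the law of the first $k$ columns of a Haar-distributed orthogonal $d\times d$ matrix), and let $E^\star_\#\mu$ be the push-forward of $\mu$ under $x\mapsto E^\top x$. For Borel probability measures $\mu,\nu$ on $\mathbb{R}^d$ define the projection robust Wasserstein (PRW) and integral projection robust Wasserstein (IPRW) distances $$\overline{\mathcal{PW}}_{p,k}(\mu,\nu)=\sup_{E\in\mathbb{S}_{d,k}}\mathcal{W}_p(E^\star_\#\mu,E^\star_\#\nu),\qquad \underline{\mathcal{PW}}_{p,k}(\mu,\nu)=\Big(\int_{\mathbb{S}_{d,k}}\mathcal{W}_p^p(E^\star_\#\mu,E^\star_\#\nu)\,d\sigma(E)\Big)^{1/p}.$$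 A Borel probability measure $\mu$ on $\mathbb{R}^d$ satisfies the Poincaré inequality with constant $M>0$ if, for $X\sim\mu$, $\mathrm{Var}[f(X)]\le M\,\mathbb{E}[\|\nabla f(X)\|^2]$ for every continuously differentiable $f:\mathbb{R}^d\to\mathbb{R}$ with $\mathbb{E}[f(X)^2]<\infty$ and $\mathbb{E}[\|\nabla f(X)\|^2]<\infty$. Theorem. For every $M>0$ there is a constant $K>0$, depending only on $M$, such that the following holds for all integers $1\le k\le d$ and $n\ge1$, all real $p\ge1$, and every Borel probability measure $\mu_\star$ on $\mathbb{R}^d$ that satisfies the Poincaré inequality with constant $M$. Let $X_1,\dots,X_n$ be independent random vectors with law $\mu_\star$, let $\widehat\mu_n=\frac1n\sum_{i=1}^n\delta_{X_i}$, and let $W$ be either $\underline{\mathcal{PW}}_{p,k}$ or $\overline{\mathcal{PW}}_{p,k}$. Then $W(\widehat\mu_n,\mu_\star)$ is finite and integrable, and for every real $t$ $$\mathbb{P}\big(|W(\widehat\mu_n,\mu_\star)-\mathbb{E}[W(\widehat\mu_n,\mu_\star)]|\ge t\big)\le 2\exp\!\big(-K^{-1}\min\{n^{1/p}\,t,\ n^{2/\max\{2,p\}}\,t^2\}\big).$$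 -/

import Mathlib

open MeasureTheory ProbabilityTheory
open scoped ENNReal Matrix Gradient

noncomputable section

namespace ProjOT

/-- Wasserstein distance of order `p` on `ℝᵐ` with the Euclidean norm, with values in `[0, ∞]`.
For probability measures `μ`, `ν` every measure `π` with these marginals is a probability measure,
so the infimum is over all couplings of `μ` and `ν`. -/
def wasserstein {m : ℕ} (p : ℝ) (μ ν : Measure (EuclideanSpace ℝ (Fin m))) : ℝ≥0∞ :=
  (⨅ π ∈ {π : Measure (EuclideanSpace ℝ (Fin m) × EuclideanSpace ℝ (Fin m)) |
      π.map Prod.fst = μ ∧ π.map Prod.snd = ν},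
    ∫⁻ z, ‖z.1 - z.2‖ₑ ^ p ∂π) ^ (1 / p)

/-- The `d × k` matrices `E` with `Eᵀ E = I`. -/
abbrev Stiefel (d k : ℕ) : Type := {E : Matrix (Fin d) (Fin k) ℝ // Eᵀ * E = 1}

/-- The linear map `x ↦ Eᵀ x` from `ℝᵈ` to `ℝᵏ`. -/
def proj {d k : ℕ} (E : Stiefel d k) (x : EuclideanSpace ℝ (Fin d)) : EuclideanSpace ℝ (Fin k) :=
  WithLp.toLp 2 (E.1ᵀ *ᵥ x.ofLp)

/-- Borel σ-algebra of the orthogonal group. -/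
instance instMeasurableSpaceOrthogonal (d : ℕ) :
    MeasurableSpace (Matrix.orthogonalGroup (Fin d) ℝ) := borel _

instance instBorelSpaceOrthogonal (d : ℕ) :
    BorelSpace (Matrix.orthogonalGroup (Fin d) ℝ) := ⟨rfl⟩

/-- Borel σ-algebra of the set of `d × k` matrices with orthonormal columns. -/
instance instMeasurableSpaceStiefel (d k : ℕ) : MeasurableSpace (Stiefel d k) := borel _

instance instBorelSpaceStiefel (d k : ℕ) : BorelSpace (Stiefel d k) := ⟨rfl⟩

instance instCompactSpaceOrthogonal (d : ℕ) :
    CompactSpace (Matrix.orthogonalGroup (Fin d) ℝ) := by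
  refine isCompact_iff_compactSpace.mp ?_
  have hK : IsCompact (Set.univ.pi fun _ : Fin d => Set.univ.pi fun _ : Fin d =>
      Metric.closedBall (0 : ℝ) 1) :=
    isCompact_univ_pi fun _ => isCompact_univ_pi fun _ => isCompact_closedBall _ _
  refine IsCompact.of_isClosed_subset hK (isClosed_unitary (R := Matrix (Fin d) (Fin d) ℝ)) ?_
  intro U hU i _ j _
  simpa using entry_norm_bound_of_unitary hU i j

/-- The first `k` columns of an orthogonal `d × d` matrix. -/
def firstColumns {d k : ℕ} (h : k ≤ d) (Q : Matrix.orthogonalGroup (Fin d) ℝ) : Stiefel d k :=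
  ⟨Q.1.submatrix id (Fin.castLE h), by
    have hQ : Q.1ᵀ * Q.1 = 1 := (Matrix.mem_orthogonalGroup_iff' (Fin d) ℝ).mp Q.2
    ext i j
    have hij := congrFun (congrFun hQ (Fin.castLE h i)) (Fin.castLE h j)
    simpa [Matrix.mul_apply, Matrix.one_apply] using hij⟩

/-- The uniform distribution on the `d × k` matrices with orthonormal columns: the law of the
first `k` columns of a random matrix that follows the Haar probability measure of the
orthogonal group. -/
def stiefelUniform {d k : ℕ} (h : k ≤ d) : Measure (Stiefel d k) :=
  (Measure.haarMeasure (⊤ : TopologicalSpace.PositiveCompacts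
    (Matrix.orthogonalGroup (Fin d) ℝ))).map (firstColumns h)

lemma continuous_firstColumns {d k : ℕ} (h : k ≤ d) : Continuous (firstColumns h) :=
  Continuous.subtype_mk (continuous_subtype_val.matrix_submatrix _ _) _

instance instIsProbabilityMeasureStiefelUniform {d k : ℕ} (h : k ≤ d) :
    IsProbabilityMeasure (stiefelUniform h) := by
  have : IsProbabilityMeasure (Measure.haarMeasure (⊤ : TopologicalSpace.PositiveCompacts
      (Matrix.orthogonalGroup (Fin d) ℝ))) := ⟨by
    simpa using Measure.haarMeasure_self (K₀ := (⊤ : TopologicalSpace.PositiveCompacts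
      (Matrix.orthogonalGroup (Fin d) ℝ)))⟩
  exact Measure.isProbabilityMeasure_map (continuous_firstColumns h).measurable.aemeasurable

/-- Projection robust Wasserstein (PRW) distance of order `p`. -/
def prw {d : ℕ} (p : ℝ) (k : ℕ) (μ ν : Measure (EuclideanSpace ℝ (Fin d))) : ℝ≥0∞ :=
  ⨆ E : Stiefel d k, wasserstein p (μ.map (proj E)) (ν.map (proj E))

/-- Integral projection robust Wasserstein (IPRW) distance of order `p`. -/
def iprw {d k : ℕ} (p : ℝ) (h : k ≤ d) (μ ν : Measure (EuclideanSpace ℝ (Fin d))) : ℝ≥0∞ :=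
  (∫⁻ E, wasserstein p (μ.map (proj E)) (ν.map (proj E)) ^ p ∂stiefelUniform h) ^ (1 / p)

/-- The empirical measure `(1/n) ∑ᵢ δ_{xᵢ}`. -/
def empirical {d n : ℕ} (x : Fin n → EuclideanSpace ℝ (Fin d)) :
    Measure (EuclideanSpace ℝ (Fin d)) :=
  (n : ℝ≥0∞)⁻¹ • ∑ i, Measure.dirac (x i)

/-- The Poincaré inequality with constant `M`: `Var f(X) ≤ M E‖∇f(X)‖²` for `X ∼ μ` and all
continuously differentiable `f` such that `f(X)` and `∇f(X)` are square integrable. -/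
def Poincare {d : ℕ} (M : ℝ) (μ : Measure (EuclideanSpace ℝ (Fin d))) : Prop :=
  ∀ f : EuclideanSpace ℝ (Fin d) → ℝ, ContDiff ℝ 1 f →
    Integrable (fun x => f x ^ 2) μ → Integrable (fun x => ‖∇ f x‖ ^ 2) μ →
    Var[f; μ] ≤ M * ∫ x, ‖∇ f x‖ ^ 2 ∂μ

end ProjOT

end

/-! ### Entropy of bounded exponentials and its tensorization. -/

namespace ProjOT

/-! Both distances, as functions of the sample `x = (x₁, …, xₙ)`, change by at most `(n⁻¹ ∑ ‖xᵢ -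
yᵢ‖ ^ p) ^ (1 / p)` when `x` is replaced by `y`: couple the two empirical measures by pairing equal
indices, note that `x ↦ Eᵀ x` is a contraction, and use the triangle inequality, then a supremum or
Minkowski's inequality over `E`. Hence the statistic is Lipschitz for the Euclidean norm of the
whole sample with constant `α = n ^ (-1 / max 2 p)` (`rpow_mean_le`), and in each single variable
with constant `β = n ^ (-1 / p)`. No dimension enters. This is `mixedLipschitz_toReal`.

It remains to prove the Bobkov–Ledoux concentration inequality for such functions under a product of
measures with a Poincaré inequality. The Poincaré inequality implies a modified logarithmic Sobolev
inequality `Ent(e^g) ≤ 7 M E[‖∇g‖² e^g]`, valid as long as `M ‖∇g‖² ≤ 1/20` everywhere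
(`Poincare.entExp_le`). Entropy is subadditive on products, so the inequality may be used one
variable at a time (`entExp_pi_le`): the smallness condition concerns only the partial gradients,
bounded by `β`, whereas the sum of their squares is bounded by `α²`. Herbst's argument
(`integral_exp_le_of_entExp_le`) turns this into `E exp(s(F - E F)) ≤ exp(7 M α² s²)` for `0 < s`
with `M (s β)² ≤ 1/20`. Chernoff's bound gives a Gaussian tail governed by `α` for moderate
deviations and an exponential tail governed by `β` for large ones.

The analysis is done for smooth bounded `F`; mollification and truncation remove these assumptions
and also give integrability. -/

lemma integrable_of_abs_le {X : Type*} [MeasurableSpace X] {μ : Measure X} [IsFiniteMeasure μ]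
    {f : X → ℝ} (hf : Measurable f) {R : ℝ} (hR : ∀ x, |f x| ≤ R) : Integrable f μ :=
  Integrable.of_bound hf.aestronglyMeasurable R (Filter.Eventually.of_forall hR)

/-- Entropy of `exp ∘ g`. -/
noncomputable def entExp {X : Type*} [MeasurableSpace X] (μ : Measure X) (g : X → ℝ) : ℝ :=
  ∫ x, g x * Real.exp (g x) ∂μ -
    (∫ x, Real.exp (g x) ∂μ) * Real.log (∫ x, Real.exp (g x) ∂μ)

section Bounded

variable {X Y : Type*} [MeasurableSpace X] [MeasurableSpace Y] {μ : Measure X} {ν : Measure Y}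
  [IsProbabilityMeasure μ] [IsProbabilityMeasure ν]

lemma abs_mul_exp_le {h g S R : ℝ} (hh : |h| ≤ S) (hg : |g| ≤ R) :
    |h * Real.exp g| ≤ S * Real.exp R := by
  rw [abs_mul, Real.abs_exp]
  have : Real.exp g ≤ Real.exp R := Real.exp_le_exp.2 (le_of_abs_le hg)
  have := (abs_nonneg h).trans hh
  gcongr

lemma abs_exp_le {g R : ℝ} (hg : |g| ≤ R) : |Real.exp g| ≤ Real.exp R := by
  rw [Real.abs_exp]; exact Real.exp_le_exp.2 (le_of_abs_le hg)

lemma integrable_exp_of_abs_le {g : X → ℝ} (hg : Measurable g) {R : ℝ} (hR : ∀ x, |g x| ≤ R) :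
    Integrable (fun x => Real.exp (g x)) μ :=
  integrable_of_abs_le (by fun_prop) fun x => abs_exp_le (hR x)

lemma integrable_mul_exp_of_abs_le {h g : X → ℝ} (hh : Measurable h) (hg : Measurable g)
    {S R : ℝ} (hS : ∀ x, |h x| ≤ S) (hR : ∀ x, |g x| ≤ R) :
    Integrable (fun x => h x * Real.exp (g x)) μ :=
  integrable_of_abs_le (by fun_prop) fun x => abs_mul_exp_le (hS x) (hR x)

lemma integral_exp_bounds {g : X → ℝ} (hg : Measurable g) {R : ℝ} (hR : ∀ x, |g x| ≤ R) :
    Real.exp (-R) ≤ ∫ x, Real.exp (g x) ∂μ ∧ ∫ x, Real.exp (g x) ∂μ ≤ Real.exp R := by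
  have hi := integrable_exp_of_abs_le (μ := μ) hg hR
  constructor
  · calc Real.exp (-R) = ∫ _, Real.exp (-R) ∂μ := by simp
      _ ≤ _ := integral_mono (integrable_const _) hi
        fun x => Real.exp_le_exp.2 (neg_le_of_abs_le (hR x))
  · calc _ ≤ ∫ _, Real.exp R ∂μ := integral_mono hi (integrable_const _)
            fun x => Real.exp_le_exp.2 (le_of_abs_le (hR x))
      _ = _ := by simp

lemma integral_exp_pos' {g : X → ℝ} (hg : Measurable g) {R : ℝ} (hR : ∀ x, |g x| ≤ R) :
    0 < ∫ x, Real.exp (g x) ∂μ :=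
  (Real.exp_pos _).trans_le (integral_exp_bounds hg hR).1

lemma abs_log_integral_exp_le {g : X → ℝ} (hg : Measurable g) {R : ℝ} (hR : ∀ x, |g x| ≤ R) :
    |Real.log (∫ x, Real.exp (g x) ∂μ)| ≤ R := by
  obtain ⟨h1, h2⟩ := integral_exp_bounds (μ := μ) hg hR
  have hpos := integral_exp_pos' (μ := μ) hg hR
  exact abs_le.2 ⟨(Real.le_log_iff_exp_le hpos).2 h1, (Real.log_le_iff_le_exp hpos).2 h2⟩

/-- The Gibbs variational inequality. -/
lemma integral_mul_exp_le_entExp {h g : X → ℝ} (hh : Measurable h) (hg : Measurable g) {S R : ℝ}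
    (hS : ∀ x, |h x| ≤ S) (hR : ∀ x, |g x| ≤ R) (h1 : ∫ x, Real.exp (h x) ∂μ = 1) :
    ∫ x, h x * Real.exp (g x) ∂μ ≤ entExp μ g := by
  set Z := ∫ x, Real.exp (g x) ∂μ with hZ
  have hZpos : 0 < Z := integral_exp_pos' hg hR
  -- This is `a + 1 ≤ exp a` at `a = h x - g x + log Z`, multiplied by `exp (g x)`; after
  -- integration the last two terms cancel because `∫ exp h = 1`.
  have hpt : ∀ x, h x * Real.exp (g x) ≤
      g x * Real.exp (g x) - Real.log Z * Real.exp (g x) - Real.exp (g x) + Z * Real.exp (h x) := by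
    intro x
    have h2 := Real.add_one_le_exp (h x - g x + Real.log Z)
    have h3 : Real.exp (h x - g x + Real.log Z) * Real.exp (g x) = Z * Real.exp (h x) := by
      rw [← Real.exp_add, show h x - g x + Real.log Z + g x = Real.log Z + h x by ring,
        Real.exp_add, Real.exp_log hZpos]
    have h4 := mul_le_mul_of_nonneg_right h2 (Real.exp_pos (g x)).le
    rw [h3] at h4
    linarith
  have i1 := integrable_mul_exp_of_abs_le (μ := μ) hg hg hR hR
  have i2 := integrable_exp_of_abs_le (μ := μ) hg hR
  have i3 := integrable_exp_of_abs_le (μ := μ) hh hS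
  have i4 : Integrable (fun x => g x * Real.exp (g x) - Real.log Z * Real.exp (g x)) μ :=
    i1.sub (i2.const_mul _)
  have i5 : Integrable
      (fun x => g x * Real.exp (g x) - Real.log Z * Real.exp (g x) - Real.exp (g x)) μ := i4.sub i2
  calc ∫ x, h x * Real.exp (g x) ∂μ ≤ ∫ x, (g x * Real.exp (g x) - Real.log Z * Real.exp (g x)
        - Real.exp (g x) + Z * Real.exp (h x)) ∂μ :=
        integral_mono (integrable_mul_exp_of_abs_le hh hg hS hR)
          (i5.add (i3.const_mul _)) hpt
    _ = entExp μ g := by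
        rw [integral_add i5 (i3.const_mul _), integral_sub i4 i2, integral_sub i1 (i2.const_mul _),
          integral_const_mul, integral_const_mul, h1, entExp, ← hZ]
        ring

lemma measurable_log_integral_exp {g : X × Y → ℝ} (hg : Measurable g) :
    Measurable fun x => Real.log (∫ y, Real.exp (g (x, y)) ∂ν) := by
  refine Real.measurable_log.comp ?_
  exact (StronglyMeasurable.integral_prod_right
    (f := fun x y => Real.exp (g (x, y))) (by
      exact (Real.measurable_exp.comp hg).stronglyMeasurable)).measurable

lemma abs_entExp_le {g : X → ℝ} (hg : Measurable g) {R : ℝ} (hR : ∀ x, |g x| ≤ R) :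
    |entExp μ g| ≤ R * Real.exp R + Real.exp R * R := by
  unfold entExp
  refine (abs_sub _ _).trans (add_le_add ?_ ?_)
  · refine (norm_integral_le_of_norm_le_const (f := fun x => g x * Real.exp (g x))
      (C := R * Real.exp R)
      (Filter.Eventually.of_forall fun x => abs_mul_exp_le (hR x) (hR x))).trans ?_
    simp
  · rw [abs_mul, abs_of_pos (integral_exp_pos' hg hR)]
    exact mul_le_mul (integral_exp_bounds hg hR).2 (abs_log_integral_exp_le hg hR)
      (abs_nonneg _) (Real.exp_pos _).le

lemma measurable_entExp_right {g : X × Y → ℝ} (hg : Measurable g) :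
    Measurable fun x => entExp ν fun y => g (x, y) := by
  have h1 : Measurable fun x => ∫ y, g (x, y) * Real.exp (g (x, y)) ∂ν :=
    (StronglyMeasurable.integral_prod_right (f := fun x y => g (x, y) * Real.exp (g (x, y))) (by
      exact (hg.mul (Real.measurable_exp.comp hg)).stronglyMeasurable)).measurable
  have h2 : Measurable fun x => ∫ y, Real.exp (g (x, y)) ∂ν :=
    (StronglyMeasurable.integral_prod_right (f := fun x y => Real.exp (g (x, y))) (by
      exact (Real.measurable_exp.comp hg).stronglyMeasurable)).measurable
  exact h1.sub (h2.mul (Real.measurable_log.comp h2))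

/-- Subadditivity of entropy for a product of two probability measures. -/
lemma entExp_prod_le {g : X × Y → ℝ} (hg : Measurable g) {R : ℝ} (hR : ∀ x, |g x| ≤ R) :
    entExp (μ.prod ν) g ≤
      ∫ x, entExp ν (fun y => g (x, y)) ∂μ + ∫ y, entExp μ (fun x => g (x, y)) ∂ν := by
  set L : X → ℝ := fun x => Real.log (∫ y, Real.exp (g (x, y)) ∂ν) with hL
  have hLm : Measurable L := measurable_log_integral_exp hg
  have hgx : ∀ x, Measurable fun y => g (x, y) := fun x => hg.comp measurable_prodMk_left
  have hgy : ∀ y, Measurable fun x => g (x, y) := fun y => hg.comp measurable_prodMk_right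
  have hLR : ∀ x, |L x| ≤ R := fun x => abs_log_integral_exp_le (hgx x) fun y => hR _
  have hexpL : ∀ x, Real.exp (L x) = ∫ y, Real.exp (g (x, y)) ∂ν := fun x =>
    Real.exp_log (integral_exp_pos' (hgx x) fun y => hR _)
  have i1 := integrable_exp_of_abs_le (μ := μ.prod ν) hg hR
  have i2 := integrable_mul_exp_of_abs_le (μ := μ.prod ν) hg hg hR hR
  set Z := ∫ z, Real.exp (g z) ∂μ.prod ν with hZ
  have hZL : Z = ∫ x, Real.exp (L x) ∂μ := by
    rw [hZ, integral_prod _ i1]; simp_rw [hexpL]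
  have hZpos : 0 < Z := integral_exp_pos' hg hR
  -- Chain rule: the mean conditional entropy plus the entropy of the marginal density `exp L`.
  have hchain : entExp (μ.prod ν) g = ∫ x, entExp ν (fun y => g (x, y)) ∂μ + entExp μ L := by
    have e1 : ∀ x, entExp ν (fun y => g (x, y)) =
        ∫ y, g (x, y) * Real.exp (g (x, y)) ∂ν - L x * Real.exp (L x) := by
      intro x
      rw [entExp, ← hexpL, Real.log_exp, mul_comm (Real.exp _)]
    simp_rw [e1]
    rw [integral_sub i2.integral_prod_left (integrable_mul_exp_of_abs_le hLm hLm hLR hLR),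
      ← integral_prod _ i2]
    rw [entExp, entExp, ← hZ, ← hZL]
    ring
  -- With `h = L - log Z`, normalised so that `∫ exp h = 1`, the entropy of `exp L` is `∫∫ h exp g`;
  -- Fubini and the Gibbs inequality for each fixed `y` bound it.
  have hvar : entExp μ L ≤ ∫ y, entExp μ (fun x => g (x, y)) ∂ν := by
    set h : X → ℝ := fun x => L x - Real.log Z with hh
    have hhm : Measurable h := hLm.sub_const _
    have hhS : ∀ x, |h x| ≤ R + R := fun x =>
      (abs_sub _ _).trans (add_le_add (hLR x) (abs_log_integral_exp_le hg hR))
    have hh1 : ∫ x, Real.exp (h x) ∂μ = 1 := by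
      simp_rw [hh, Real.exp_sub, Real.exp_log hZpos]
      rw [integral_div, ← hZL, div_self hZpos.ne']
    have i3 : Integrable (fun z : X × Y => h z.1 * Real.exp (g z)) (μ.prod ν) :=
      integrable_mul_exp_of_abs_le (hhm.comp measurable_fst) hg (fun z => hhS z.1) hR
    have e2 : entExp μ L = ∫ x, h x * Real.exp (L x) ∂μ := by
      simp_rw [hh, sub_mul]
      rw [integral_sub (integrable_mul_exp_of_abs_le hLm hLm hLR hLR)
        ((integrable_exp_of_abs_le hLm hLR).const_mul _), integral_const_mul, ← hZL, entExp, ← hZL,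
        mul_comm Z]
    have e3 : ∫ x, h x * Real.exp (L x) ∂μ =
        ∫ y, ∫ x, h x * Real.exp (g (x, y)) ∂μ ∂ν := by
      simp_rw [hexpL, ← integral_const_mul]
      exact integral_integral_swap i3
    rw [e2, e3]
    refine integral_mono i3.integral_prod_right ?_ fun y =>
      integral_mul_exp_le_entExp hhm (hgy y) hhS (fun x => hR _) hh1
    exact integrable_of_abs_le
      (measurable_entExp_right (ν := μ) (hg.comp (measurable_swap (α := Y) (β := X))))
      fun y => abs_entExp_le (hgy y) fun x => hR _
  rw [hchain]
  linarith

/-- Tensorization of entropy bounds. -/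
lemma entExp_pi_le {n : ℕ} {g : (Fin n → X) → ℝ} (hg : Measurable g) {R : ℝ}
    (hR : ∀ x, |g x| ≤ R) {H : Fin n → (Fin n → X) → ℝ} (hH : ∀ i, Measurable (H i)) {S : ℝ}
    (hS : ∀ i x, |H i x| ≤ S)
    (hent : ∀ i x, entExp μ (fun z => g (Function.update x i z)) ≤
      ∫ z, H i (Function.update x i z) ∂μ) :
    entExp (Measure.pi fun _ : Fin n => μ) g ≤
      ∑ i, ∫ x, H i x ∂(Measure.pi fun _ : Fin n => μ) := by
  induction n with
  | zero =>
    -- The product over no factors is a single point, where every entropy vanishes.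
    have hc : g = fun _ => g Fin.elim0 := funext fun x => congrArg g (Subsingleton.elim _ _)
    rw [hc, entExp]
    simp [mul_comm]
  | succ n ih =>
    set ρ := Measure.pi fun _ : Fin n => μ with hρ
    have hmp := (measurePreserving_piFinSuccAbove (fun _ : Fin (n + 1) => μ) 0).symm
    have hcons : ∀ z : X × (Fin n → X),
        (MeasurableEquiv.piFinSuccAbove (fun _ : Fin (n + 1) => X) 0).symm z =
          Fin.cons z.1 z.2 := by
      intro z
      simp [MeasurableEquiv.piFinSuccAbove, Fin.insertNthEquiv]
    have hint : ∀ f : (Fin (n + 1) → X) → ℝ, ∫ x, f x ∂(Measure.pi fun _ : Fin (n + 1) => μ) =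
        ∫ z, f (Fin.cons z.1 z.2) ∂(μ.prod ρ) := by
      intro f
      rw [← hmp.integral_comp' (g := f)]
      simp_rw [hcons]
      rfl
    have hmc : Measurable fun z : X × (Fin n → X) => (Fin.cons z.1 z.2 : Fin (n + 1) → X) := by
      have := (MeasurableEquiv.piFinSuccAbove (fun _ : Fin (n + 1) => X) 0).symm.measurable
      simpa only [funext hcons] using this
    have hgm : Measurable fun z : X × (Fin n → X) => g (Fin.cons z.1 z.2) := hg.comp hmc
    have hHm : ∀ i, Measurable fun z : X × (Fin n → X) => H i (Fin.cons z.1 z.2) :=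
      fun i => (hH i).comp hmc
    have hHi : ∀ i, Integrable (fun z : X × (Fin n → X) => H i (Fin.cons z.1 z.2)) (μ.prod ρ) :=
      fun i => integrable_of_abs_le (hHm i) fun z => hS _ _
    have he : entExp (Measure.pi fun _ : Fin (n + 1) => μ) g =
        entExp (μ.prod ρ) fun z => g (Fin.cons z.1 z.2) := by
      unfold entExp
      rw [hint, hint (fun x => Real.exp (g x))]
    rw [he, Fin.sum_univ_succ]
    refine (entExp_prod_le hgm fun z => hR _).trans ?_
    rw [add_comm]
    refine add_le_add ?_ ?_
    · rw [hint, integral_prod_symm _ (hHi 0)]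
      refine integral_mono (integrable_of_abs_le
        (measurable_entExp_right (ν := μ) (hgm.comp measurable_swap))
        fun y => abs_entExp_le (hgm.comp measurable_prodMk_right) fun x => hR _)
        (hHi 0).integral_prod_right fun y => ?_
      obtain ⟨x0⟩ : Nonempty X := μ.nonempty_of_neZero
      simpa [Fin.update_cons_zero] using hent 0 (Fin.cons x0 y)
    · simp_rw [hint, integral_prod _ (hHi _)]
      rw [← integral_finsetSum _ fun i _ => (hHi _).integral_prod_left]
      refine integral_mono (integrable_of_abs_le (measurable_entExp_right hgm)
        fun x => abs_entExp_le (hgm.comp measurable_prodMk_left) fun y => hR _)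
        (integrable_finsetSum _ fun i _ => (hHi _).integral_prod_left) fun x => ?_
      refine ih (hgm.comp measurable_prodMk_left) (fun y => hR _)
        (H := fun i y => H i.succ (Fin.cons x y))
        (fun i => (hHm i.succ).comp measurable_prodMk_left) (fun i y => hS _ _) fun i y => ?_
      simpa [Fin.cons_update] using hent i.succ (Fin.cons x y)

end Bounded

end ProjOT

/-! ### From the Poincaré inequality to a modified logarithmic Sobolev inequality. -/

namespace ProjOT

/-- Cauchy–Schwarz: the quadratic `s ↦ ∫ (s f + g)²` is nonnegative, so its discriminant is
nonpositive. -/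
lemma sq_integral_mul_le {X : Type*} [MeasurableSpace X] {μ : Measure X} {f g : X → ℝ}
    (hf : Integrable (fun x => f x ^ 2) μ) (hg : Integrable (fun x => g x ^ 2) μ)
    (hfg : Integrable (fun x => f x * g x) μ) :
    (∫ x, f x * g x ∂μ) ^ 2 ≤ (∫ x, f x ^ 2 ∂μ) * ∫ x, g x ^ 2 ∂μ := by
  have h : ∀ s : ℝ, 0 ≤ (∫ x, f x ^ 2 ∂μ) * (s * s) + (2 * ∫ x, f x * g x ∂μ) * s
      + ∫ x, g x ^ 2 ∂μ := by
    intro s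
    have e : ∫ x, (s * f x + g x) ^ 2 ∂μ = (∫ x, f x ^ 2 ∂μ) * (s * s)
        + (2 * ∫ x, f x * g x ∂μ) * s + ∫ x, g x ^ 2 ∂μ := by
      have : ∀ x, (s * f x + g x) ^ 2 = s * s * f x ^ 2 + 2 * s * (f x * g x) + g x ^ 2 :=
        fun x => by ring
      simp_rw [this]
      have i : Integrable (fun x => s * s * f x ^ 2 + 2 * s * (f x * g x)) μ :=
        (hf.const_mul _).add (hfg.const_mul _)
      rw [integral_add i hg, integral_add (hf.const_mul _) (hfg.const_mul _), integral_const_mul,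
        integral_const_mul]
      ring
    rw [← e]
    exact integral_nonneg fun x => sq_nonneg _
  have := discrim_le_zero h
  rw [discrim] at this
  linarith

/-- Homogeneity of entropy; it reduces the logarithmic Sobolev inequality to centred functions. -/
lemma entExp_add_const {X : Type*} [MeasurableSpace X] {μ : Measure X} [IsProbabilityMeasure μ]
    {u : X → ℝ} (hu : Measurable u) {R : ℝ} (hR : ∀ x, |u x| ≤ R) (m : ℝ) :
    entExp μ (fun x => u x + m) = Real.exp m * entExp μ u := by
  have i1 := integrable_mul_exp_of_abs_le (μ := μ) hu hu hR hR
  have i2 := integrable_exp_of_abs_le (μ := μ) hu hR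
  have hpos := integral_exp_pos' (μ := μ) hu hR
  have e : ∀ x, (u x + m) * Real.exp (u x + m) =
      Real.exp m * (u x * Real.exp (u x)) + Real.exp m * m * Real.exp (u x) := fun x => by
    rw [Real.exp_add]; ring
  unfold entExp
  simp_rw [e, Real.exp_add, mul_comm _ (Real.exp m)]
  rw [integral_add (i1.const_mul _) (i2.const_mul _)]
  simp_rw [integral_const_mul]
  rw [Real.log_mul (Real.exp_pos _).ne' hpos.ne', Real.log_exp]
  ring

/-- Since `Z log Z ≥ Z - 1`, the entropy is at most the integral of `u e^u - e^u + 1`, which is of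
second order in `u`. The right-hand side consists of second moments, accessible to the Poincaré
inequality. -/
lemma entExp_le_integral {X : Type*} [MeasurableSpace X] {μ : Measure X} [IsProbabilityMeasure μ]
    {u : X → ℝ} (hu : Measurable u) {R : ℝ} (hR : ∀ x, |u x| ≤ R) :
    entExp μ u ≤ ∫ x, u x ^ 2 ∂μ + ∫ x, u x ^ 2 * Real.exp (u x) ∂μ := by
  have i1 := integrable_mul_exp_of_abs_le (μ := μ) hu hu hR hR
  have i2 := integrable_exp_of_abs_le (μ := μ) hu hR
  have hpos := integral_exp_pos' (μ := μ) hu hR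
  have hR2 : ∀ x, |u x ^ 2| ≤ R ^ 2 := fun x => by
    rw [abs_pow]; exact pow_le_pow_left₀ (abs_nonneg _) (hR x) 2
  have i3 : Integrable (fun x => u x ^ 2) μ := integrable_of_abs_le (hu.pow_const 2) hR2
  have i4 := integrable_mul_exp_of_abs_le (μ := μ) (hu.pow_const 2) hu hR2 hR
  -- From `e^t ≥ 1 + t` the left side is at most `t (e^t - 1)`, which is at most `t² e^t` for `t ≥
  -- 0` and at most `t²` for `t ≤ 0`.
  have hpt : ∀ t : ℝ, t * Real.exp t - Real.exp t + 1 ≤ t ^ 2 + t ^ 2 * Real.exp t := by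
    intro t
    have h1 := Real.add_one_le_exp t
    have h2 := Real.add_one_le_exp (-t)
    have h3 : Real.exp (-t) * Real.exp t = 1 := by rw [← Real.exp_add]; simp
    have h4 := Real.exp_pos t
    rcases le_total 0 t with ht | ht
    · have h5 : Real.exp t - 1 ≤ t * Real.exp t := by nlinarith
      nlinarith
    · nlinarith [mul_nonneg (sq_nonneg t) h4.le]
  have i5 : Integrable (fun x => u x * Real.exp (u x) - Real.exp (u x)) μ := i1.sub i2
  set Z := ∫ x, Real.exp (u x) ∂μ with hZ
  have hZlog : Z - 1 ≤ Z * Real.log Z := by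
    have := Real.one_sub_inv_le_log_of_pos hpos
    have h := mul_le_mul_of_nonneg_left this hpos.le
    rw [mul_sub, mul_inv_cancel₀ hpos.ne'] at h
    linarith
  calc entExp μ u ≤ ∫ x, u x * Real.exp (u x) ∂μ - Z + 1 := by
        rw [entExp, ← hZ]; linarith
    _ = ∫ x, (u x * Real.exp (u x) - Real.exp (u x) + 1) ∂μ := by
        rw [integral_add i5 (integrable_const 1), integral_sub i1 i2, ← hZ]; simp
    _ ≤ ∫ x, (u x ^ 2 + u x ^ 2 * Real.exp (u x)) ∂μ :=
        integral_mono ((i1.sub i2).add (integrable_const 1)) (i3.add i4) fun x => hpt _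
    _ = _ := integral_add i3 i4

variable {d : ℕ} {μ : Measure (EuclideanSpace ℝ (Fin d))} {M : ℝ}

lemma norm_gradient_eq (f : EuclideanSpace ℝ (Fin d) → ℝ) (x : EuclideanSpace ℝ (Fin d)) :
    ‖∇ f x‖ = ‖fderiv ℝ f x‖ := by
  simp [gradient]

/-- The Poincaré inequality for bounded functions with bounded derivative. -/
lemma Poincare.integral_sq_le [IsProbabilityMeasure μ] (hP : Poincare M μ)
    {f : EuclideanSpace ℝ (Fin d) → ℝ} (hf : ContDiff ℝ 1 f) {R c : ℝ} (hR : ∀ x, |f x| ≤ R)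
    (hc : ∀ x, ‖fderiv ℝ f x‖ ≤ c) :
    ∫ x, f x ^ 2 ∂μ ≤ M * ∫ x, ‖fderiv ℝ f x‖ ^ 2 ∂μ + (∫ x, f x ∂μ) ^ 2 := by
  have hfm : Measurable f := hf.continuous.measurable
  have i1 : Integrable (fun x => f x ^ 2) μ := by
    refine integrable_of_abs_le (hfm.pow_const 2) (R := R ^ 2) fun x => ?_
    rw [abs_pow]; exact pow_le_pow_left₀ (abs_nonneg _) (hR x) 2
  have i2 : Integrable (fun x => ‖fderiv ℝ f x‖ ^ 2) μ := by
    refine integrable_of_abs_le ((hf.continuous_fderiv one_ne_zero).norm.pow 2).measurable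
      (R := c ^ 2) fun x => ?_
    rw [abs_of_nonneg (sq_nonneg _)]
    exact pow_le_pow_left₀ (norm_nonneg _) (hc x) 2
  have h := hP f hf i1 (by simpa only [norm_gradient_eq] using i2)
  simp only [norm_gradient_eq] at h
  rw [variance_eq_sub ((memLp_two_iff_integrable_sq hfm.aestronglyMeasurable).2 i1)] at h
  simp only [Pi.pow_apply] at h
  linarith

/-- Modified logarithmic Sobolev inequality, for centred functions. -/
lemma Poincare.entExp_le_of_integral_eq_zero [IsProbabilityMeasure μ] (hM : 0 < M)
    (hP : Poincare M μ) {u : EuclideanSpace ℝ (Fin d) → ℝ} (hu : ContDiff ℝ 1 u) {R c : ℝ}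
    (hR : ∀ x, |u x| ≤ R) (hc : ∀ x, ‖fderiv ℝ u x‖ ≤ c) (hMc : M * c ^ 2 ≤ 1 / 20)
    (h0 : ∫ x, u x ∂μ = 0) :
    entExp μ u ≤ 7 * M * ∫ x, ‖fderiv ℝ u x‖ ^ 2 * Real.exp (u x) ∂μ := by
  have hum : Measurable u := hu.continuous.measurable
  have hDm : Measurable fun x => ‖fderiv ℝ u x‖ := (hu.continuous_fderiv one_ne_zero).norm.measurable
  have hR0 : 0 ≤ R := (abs_nonneg _).trans (hR 0)
  have hc0 : 0 ≤ c := (norm_nonneg _).trans (hc 0)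
  have hdiff : ∀ x, HasFDerivAt u (fderiv ℝ u x) x :=
    fun x => ((hu.differentiable one_ne_zero) x).hasFDerivAt
  have bpow : ∀ (k : ℕ) x, |u x ^ k| ≤ R ^ k := fun k x => by
    rw [abs_pow]; exact pow_le_pow_left₀ (abs_nonneg _) (hR x) k
  have bD : ∀ x, |‖fderiv ℝ u x‖ ^ 2| ≤ c ^ 2 := fun x => by
    rw [abs_of_nonneg (sq_nonneg _)]; exact pow_le_pow_left₀ (norm_nonneg _) (hc x) 2
  have bhalf : ∀ x, |u x / 2| ≤ R := fun x => by
    rw [abs_div, abs_two]; linarith [hR x, abs_nonneg (u x)]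
  set A := ∫ x, ‖fderiv ℝ u x‖ ^ 2 * Real.exp (u x) ∂μ with hA
  set B := ∫ x, u x ^ 2 * Real.exp (u x) ∂μ with hB
  set V := ∫ x, u x ^ 2 ∂μ with hV
  have iu : Integrable u μ := integrable_of_abs_le hum hR
  have i2 : Integrable (fun x => u x ^ 2) μ := integrable_of_abs_le (hum.pow_const 2) (bpow 2)
  have i4 : Integrable (fun x => u x ^ 4) μ := integrable_of_abs_le (hum.pow_const 4) (bpow 4)
  have iD : Integrable (fun x => ‖fderiv ℝ u x‖ ^ 2) μ := integrable_of_abs_le (hDm.pow_const 2) bD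
  have iB : Integrable (fun x => u x ^ 2 * Real.exp (u x)) μ :=
    integrable_mul_exp_of_abs_le (hum.pow_const 2) hum (bpow 2) hR
  have iA : Integrable (fun x => ‖fderiv ℝ u x‖ ^ 2 * Real.exp (u x)) μ :=
    integrable_mul_exp_of_abs_le (hDm.pow_const 2) hum bD hR
  have hA0 : 0 ≤ A := integral_nonneg fun x => by positivity
  have hV0 : 0 ≤ V := integral_nonneg fun x => by positivity
  have hVc : V ≤ M * c ^ 2 := by
    have h := hP.integral_sq_le hu hR hc
    rw [h0] at h
    have h2 : ∫ x, ‖fderiv ℝ u x‖ ^ 2 ∂μ ≤ ∫ _, c ^ 2 ∂μ :=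
      integral_mono iD (integrable_const _) fun x => le_of_abs_le (bD x)
    simp only [integral_const, probReal_univ, one_smul] at h2
    nlinarith
  -- fourth moment
  have h4 : ∫ x, u x ^ 4 ∂μ ≤ V / 4 := by
    have hd : ∀ x, fderiv ℝ (fun x => u x ^ 2) x = (2 * u x) • fderiv ℝ u x := fun x => by
      rw [((hdiff x).pow 2).fderiv]; simp
    have hn : ∀ x, ‖fderiv ℝ (fun x => u x ^ 2) x‖ ^ 2 = 4 * (u x ^ 2 * ‖fderiv ℝ u x‖ ^ 2) :=
      fun x => by rw [hd, norm_smul, Real.norm_eq_abs, mul_pow, sq_abs]; ring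
    -- Poincaré for `u²` gives `∫ u⁴ ≤ 4 M c² V + V² ≤ V / 5 + V / 20`, using `V ≤ M c² ≤ 1 / 20`.
    have h := hP.integral_sq_le (hu.pow 2) (bpow 2) (c := 2 * R * c) fun x => by
      rw [hd, norm_smul, Real.norm_eq_abs, abs_mul, abs_two]
      exact mul_le_mul (by linarith [hR x]) (hc x) (norm_nonneg _) (by positivity)
    simp_rw [hn, ← pow_mul] at h
    have h2 : ∫ x, 4 * (u x ^ 2 * ‖fderiv ℝ u x‖ ^ 2) ∂μ ≤ ∫ x, 4 * c ^ 2 * u x ^ 2 ∂μ := by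
      refine integral_mono_of_nonneg (Filter.Eventually.of_forall fun x => by positivity)
        (i2.const_mul _) (Filter.Eventually.of_forall fun x => ?_)
      have := le_of_abs_le (bD x)
      have := mul_le_mul_of_nonneg_left this (sq_nonneg (u x))
      dsimp only
      linarith
    rw [integral_const_mul (4 * c ^ 2)] at h2
    have h3 := mul_le_mul_of_nonneg_left h2 hM.le
    have h5 := mul_le_mul_of_nonneg_right (hVc.trans hMc) hV0
    have h6 := mul_le_mul_of_nonneg_right hMc hV0
    norm_num only at h
    rw [← hV] at h h3
    linarith
  -- The unweighted second moment is absorbed by the weighted one: `t² e^t ≥ t² + t³ ≥ (3/4) t² -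
  -- t⁴`, and the fourth moment is at most `V / 4`.
  have hVB : V ≤ 2 * B := by
    have hpt : ∀ t : ℝ, 3 / 4 * t ^ 2 - t ^ 4 ≤ t ^ 2 * Real.exp t := fun t => by
      have h1 := mul_le_mul_of_nonneg_left (Real.add_one_le_exp t) (sq_nonneg t)
      have h2 : 0 ≤ t ^ 2 * (t + 1 / 2) ^ 2 := by positivity
      nlinarith
    have h := integral_mono ((i2.const_mul (3 / 4)).sub i4) iB fun x => hpt (u x)
    rw [integral_sub' (i2.const_mul _) i4, integral_const_mul] at h
    linarith
  have hE : ∀ x, Real.exp (u x / 2) ^ 2 = Real.exp (u x) := fun x => by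
    rw [← Real.exp_nat_mul]; congr 1; push_cast; ring
  have hce : ContDiff ℝ 1 fun x => Real.exp (u x / 2) := (hu.div_const 2).exp
  have hde : ∀ x, HasFDerivAt (fun x => Real.exp (u x / 2))
      ((Real.exp (u x / 2) * (1 / 2)) • fderiv ℝ u x) x := fun x => by
    have := ((hdiff x).const_mul (1 / 2 : ℝ)).exp
    rw [smul_smul] at this
    refine (this.congr_of_eventuallyEq (Filter.Eventually.of_forall fun y => ?_)).congr_fderiv ?_
    · show _ = Real.exp _; congr 1; ring
    · congr 3; ring
  -- variance of `exp (u / 2)`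
  have hW : ∫ x, (Real.exp (u x / 2) - ∫ y, Real.exp (u y / 2) ∂μ) ^ 2 ∂μ ≤ M / 4 * A := by
    set b := ∫ y, Real.exp (u y / 2) ∂μ with hb
    have hd : ∀ x, fderiv ℝ (fun x => Real.exp (u x / 2) - b) x =
        (Real.exp (u x / 2) * (1 / 2)) • fderiv ℝ u x := fun x => ((hde x).sub_const b).fderiv
    have ie := integrable_exp_of_abs_le (μ := μ) (hum.div_const 2) bhalf
    have h := hP.integral_sq_le (hce.sub contDiff_const) (R := Real.exp R + |b|)
      (c := Real.exp R * c) (f := fun x => Real.exp (u x / 2) - b)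
      (fun x => (abs_sub _ _).trans (add_le_add (abs_exp_le (bhalf x)) le_rfl)) fun x => by
        rw [hd, norm_smul, Real.norm_eq_abs, abs_mul]
        have := abs_exp_le (bhalf x)
        refine mul_le_mul ?_ (hc x) (norm_nonneg _) (Real.exp_pos _).le
        rw [abs_of_pos (by norm_num : (0 : ℝ) < 1 / 2)]
        nlinarith [abs_nonneg (Real.exp (u x / 2))]
    have hz : ∫ x, (Real.exp (u x / 2) - b) ∂μ = 0 := by
      rw [integral_sub ie (integrable_const _)]; simp [hb]
    have hn : ∀ x, ‖fderiv ℝ (fun x => Real.exp (u x / 2) - b) x‖ ^ 2 =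
        1 / 4 * (‖fderiv ℝ u x‖ ^ 2 * Real.exp (u x)) := fun x => by
      rw [hd, norm_smul, Real.norm_eq_abs, mul_pow, sq_abs, mul_pow, hE]; ring
    rw [hz] at h
    simp_rw [hn, integral_const_mul] at h
    linarith
  -- Because `u` is centred, `exp (u / 2)` may be replaced by its deviation from its mean;
  -- Cauchy–Schwarz then gives `V` times a variance.
  have hmean : (∫ x, u x * Real.exp (u x / 2) ∂μ) ^ 2 ≤ M / 80 * A := by
    set b := ∫ y, Real.exp (u y / 2) ∂μ with hb
    have ie := integrable_mul_exp_of_abs_le (μ := μ) hum (hum.div_const 2) hR bhalf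
    have bw : ∀ x, |Real.exp (u x / 2) - b| ≤ Real.exp R + |b| := fun x =>
      (abs_sub _ _).trans (add_le_add (abs_exp_le (bhalf x)) le_rfl)
    have hwm : Measurable fun x => Real.exp (u x / 2) - b := by fun_prop
    have e : ∫ x, u x * Real.exp (u x / 2) ∂μ = ∫ x, u x * (Real.exp (u x / 2) - b) ∂μ := by
      simp_rw [mul_sub]
      rw [integral_sub ie (iu.mul_const _), integral_mul_const, h0]
      simp
    rw [e]
    refine (sq_integral_mul_le i2 (integrable_of_abs_le (hwm.pow_const 2)
      (R := (Real.exp R + |b|) ^ 2) fun x => ?_) (integrable_of_abs_le (hum.mul hwm)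
      (R := R * (Real.exp R + |b|)) fun x => ?_)).trans ?_
    · rw [abs_pow]; exact pow_le_pow_left₀ (abs_nonneg _) (bw x) 2
    · rw [abs_mul]; exact mul_le_mul (hR x) (bw x) (abs_nonneg _) hR0
    · calc _ ≤ 1 / 20 * (M / 4 * A) :=
            mul_le_mul (hVc.trans hMc) hW (integral_nonneg fun x => sq_nonneg _) (by norm_num)
        _ = _ := by ring
  -- Poincaré for `u exp (u / 2)`, whose second moment is `B`; the term in `B` on the right has
  -- coefficient at most `1 / 40` and is absorbed at the end.
  have hBA : B ≤ 2 * M * A + M * c ^ 2 / 2 * B + M / 80 * A := by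
    have hd : ∀ x, fderiv ℝ (fun x => u x * Real.exp (u x / 2)) x =
        (Real.exp (u x / 2) * (1 + u x / 2)) • fderiv ℝ u x := fun x => by
      refine ((hdiff x).mul (hde x)).fderiv.trans ?_
      rw [smul_smul, ← add_smul]
      congr 1; ring
    have h := hP.integral_sq_le (hu.mul hce) (R := R * Real.exp R)
      (f := fun x => u x * Real.exp (u x / 2))
      (c := Real.exp R * (1 + R) * c) (fun x => abs_mul_exp_le (hR x) (bhalf x)) fun x => by
        rw [hd, norm_smul, Real.norm_eq_abs, abs_mul]
        refine mul_le_mul (mul_le_mul (abs_exp_le (bhalf x)) ?_ (abs_nonneg _) (Real.exp_pos _).le)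
          (hc x) (norm_nonneg _) (by positivity)
        exact (abs_add_le _ _).trans (by rw [abs_one]; linarith [bhalf x])
    have hsq : ∀ x, (u x * Real.exp (u x / 2)) ^ 2 = u x ^ 2 * Real.exp (u x) := fun x => by
      rw [mul_pow, hE]
    have hn : ∀ x, ‖fderiv ℝ (fun x => u x * Real.exp (u x / 2)) x‖ ^ 2 ≤
        2 * (‖fderiv ℝ u x‖ ^ 2 * Real.exp (u x)) + c ^ 2 / 2 * (u x ^ 2 * Real.exp (u x)) := by
      intro x
      rw [hd, norm_smul, Real.norm_eq_abs, mul_pow, sq_abs, mul_pow, hE]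
      have h1 : (1 + u x / 2) ^ 2 ≤ 2 + u x ^ 2 / 2 := by nlinarith [sq_nonneg (1 - u x / 2)]
      have h2 : 0 ≤ Real.exp (u x) * ‖fderiv ℝ u x‖ ^ 2 := by positivity
      have h3 := mul_le_mul_of_nonneg_right h1 h2
      have h4 : 0 ≤ u x ^ 2 / 2 * Real.exp (u x) := by positivity
      have h5 := mul_le_mul_of_nonneg_left (le_of_abs_le (bD x)) h4
      nlinarith
    have h2 := integral_mono_of_nonneg (Filter.Eventually.of_forall fun x => by positivity)
      ((iA.const_mul 2).add (iB.const_mul (c ^ 2 / 2))) (Filter.Eventually.of_forall hn)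
    rw [integral_add' (iA.const_mul 2) (iB.const_mul (c ^ 2 / 2)), integral_const_mul,
      integral_const_mul] at h2
    simp_rw [hsq] at h
    have h3 := mul_le_mul_of_nonneg_left h2 hM.le
    linarith
  have hB0 : 0 ≤ B := integral_nonneg fun x => by positivity
  have hMA : 0 ≤ M * A := mul_nonneg hM.le hA0
  -- Altogether `(39/40) B ≤ (2 + 1/80) M A`, and the entropy is at most `V + B ≤ 3 B ≤ 7 M A`.
  have h5 := mul_le_mul_of_nonneg_right hMc hB0
  have h6 := entExp_le_integral (μ := μ) hum hR
  rw [← hV, ← hB] at h6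
  linarith

/-- Modified logarithmic Sobolev inequality of a measure with a Poincaré inequality. -/
lemma Poincare.entExp_le [IsProbabilityMeasure μ] (hM : 0 < M) (hP : Poincare M μ)
    {g : EuclideanSpace ℝ (Fin d) → ℝ} (hg : ContDiff ℝ 1 g) {R c : ℝ} (hR : ∀ x, |g x| ≤ R)
    (hc : ∀ x, ‖fderiv ℝ g x‖ ≤ c) (hMc : M * c ^ 2 ≤ 1 / 20) :
    entExp μ g ≤ 7 * M * ∫ x, ‖fderiv ℝ g x‖ ^ 2 * Real.exp (g x) ∂μ := by
  set m := ∫ x, g x ∂μ with hm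
  have hgm : Measurable g := hg.continuous.measurable
  have hb : ∀ x, |g x - m| ≤ R + |m| := fun x =>
    (abs_sub _ _).trans (add_le_add (hR x) le_rfl)
  have hfd : ∀ x, fderiv ℝ (fun x => g x - m) x = fderiv ℝ g x := fun x => fderiv_sub_const m
  have h := hP.entExp_le_of_integral_eq_zero hM (u := fun x => g x - m) (hg.sub contDiff_const) hb
    (c := c) (fun x => by rw [hfd]; exact hc x) hMc
    (by rw [integral_sub (integrable_of_abs_le hgm hR) (integrable_const _)]; simp [hm])
  have e := entExp_add_const (μ := μ) (hgm.sub_const m) hb m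
  simp only [sub_add_cancel] at e
  rw [e]
  refine (mul_le_mul_of_nonneg_left h (Real.exp_pos m).le).trans_eq ?_
  simp_rw [hfd]
  rw [mul_left_comm, ← integral_const_mul]
  congr 2
  ext x
  rw [Real.exp_sub]
  field_simp

end ProjOT

/-! ### Herbst's argument and mixed Lipschitz functions. -/

namespace ProjOT

/-- Herbst's argument. -/
lemma integral_exp_le_of_entExp_le {X : Type*} [MeasurableSpace X] {μ : Measure X}
    [IsProbabilityMeasure μ] {F : X → ℝ} (hF : Measurable F) {R κ b : ℝ} (hR : ∀ x, |F x| ≤ R)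
    (h : ∀ s, 0 < s → s ≤ b →
      entExp μ (fun x => s * F x) ≤ κ * s ^ 2 * ∫ x, Real.exp (s * F x) ∂μ)
    {s : ℝ} (hs : 0 < s) (hsb : s ≤ b) :
    ∫ x, Real.exp (s * F x) ∂μ ≤ Real.exp (s * ∫ x, F x ∂μ + κ * s ^ 2) := by
  have hbd : ∀ (s : ℝ) x, |s * F x| ≤ |s| * R := fun s x => by
    rw [abs_mul]; exact mul_le_mul_of_nonneg_left (hR x) (abs_nonneg _)
  have hint : ∀ s : ℝ, Integrable (fun x => Real.exp (s * F x)) μ := fun s =>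
    integrable_exp_of_abs_le (hF.const_mul s) (hbd s)
  have hset : ∀ s : ℝ, s ∈ interior (integrableExpSet F μ) := fun s => by
    have : integrableExpSet F μ = Set.univ := Set.eq_univ_of_forall hint
    rw [this, interior_univ]; trivial
  have hpos : ∀ s : ℝ, 0 < mgf F μ s := fun s => mgf_pos (hint s)
  have hder : ∀ s : ℝ, HasDerivAt (cgf F μ)
      ((∫ x, F x * Real.exp (s * F x) ∂μ) / mgf F μ s) s := fun s => by
    have := (analyticAt_cgf (hset s)).differentiableAt.hasDerivAt
    rwa [deriv_cgf (hset s)] at this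
  -- The entropy bound says precisely that the derivative of `cgf / s` is at most `κ`, so `ψ`
  -- decreases; its limit at `0` from the right is the mean of `F`.
  set ψ : ℝ → ℝ := fun s => cgf F μ s / s - κ * s with hψ
  have hdψ : ∀ s, 0 < s → HasDerivAt ψ
      (((∫ x, F x * Real.exp (s * F x) ∂μ) / mgf F μ s * s - cgf F μ s * 1) / s ^ 2 - κ * 1) s :=
    fun s hs => ((hder s).div (hasDerivAt_id s) hs.ne').sub ((hasDerivAt_id s).const_mul κ)
  have hanti : AntitoneOn ψ (Set.Ioc 0 b) := by
    refine antitoneOn_of_deriv_nonpos (convex_Ioc 0 b)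
      (fun s hs => (hdψ s hs.1).continuousAt.continuousWithinAt)
      (fun s hs => (hdψ s (interior_subset hs).1).differentiableAt.differentiableWithinAt)
      fun s hs => ?_
    obtain ⟨hs0, hsb⟩ := interior_subset hs
    rw [(hdψ s hs0).deriv]
    have h1 := h s hs0 hsb
    have e : ∫ x, s * F x * Real.exp (s * F x) ∂μ = s * ∫ x, F x * Real.exp (s * F x) ∂μ := by
      rw [← integral_const_mul]; congr 1; ext x; ring
    have e2 : ∫ x, Real.exp (s * F x) ∂μ = mgf F μ s := rfl
    have hlog : Real.log (mgf F μ s) = cgf F μ s := rfl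
    rw [entExp, e, e2, hlog] at h1
    have hp := hpos s
    rw [sub_nonpos, mul_one, mul_one, div_le_iff₀ (by positivity), div_mul_eq_mul_div,
      sub_le_iff_le_add, div_le_iff₀ hp]
    linarith
  have hlim : Filter.Tendsto ψ (nhdsWithin 0 (Set.Ioi 0)) (nhds (∫ x, F x ∂μ)) := by
    have h1 := (hder 0).tendsto_slope_zero_right
    simp only [zero_add, cgf_zero, sub_zero, zero_mul, Real.exp_zero, mul_one, mgf_zero, div_one,
      smul_eq_mul] at h1
    have h2 : Filter.Tendsto (fun s : ℝ => κ * s) (nhdsWithin 0 (Set.Ioi 0)) (nhds 0) := by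
      have : Filter.Tendsto (fun s : ℝ => κ * s) (nhds 0) (nhds (κ * 0)) :=
        (continuous_const.mul continuous_id).tendsto 0
      rw [mul_zero] at this
      exact this.mono_left nhdsWithin_le_nhds
    have h3 := h1.sub h2
    rw [sub_zero] at h3
    refine h3.congr fun s => ?_
    rw [hψ]; dsimp only; rw [div_eq_inv_mul]
  have hle : ψ s ≤ ∫ x, F x ∂μ := by
    refine ge_of_tendsto hlim ?_
    filter_upwards [Ioo_mem_nhdsGT hs] with t ht
    exact hanti ⟨ht.1, ht.2.le.trans hsb⟩ ⟨hs, hsb⟩ ht.2.le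
  have h4 : cgf F μ s ≤ s * ∫ x, F x ∂μ + κ * s ^ 2 := by
    rw [hψ] at hle
    dsimp only at hle
    rw [sub_le_iff_le_add, div_le_iff₀ hs] at hle
    linarith
  calc ∫ x, Real.exp (s * F x) ∂μ = Real.exp (cgf F μ s) := (Real.exp_log (hpos s)).symm
    _ ≤ _ := Real.exp_le_exp.2 h4

/-- `F` is `α`-Lipschitz for the `ℓ²` norm on the product, and `β`-Lipschitz in each variable. -/
structure MixedLipschitz {n : ℕ} {E : Type*} [NormedAddCommGroup E] (α β : ℝ)
    (F : (Fin n → E) → ℝ) : Prop where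
  abs_sub_le : ∀ x y, |F x - F y| ≤ α * √(∑ i, ‖x i - y i‖ ^ 2)
  abs_update_sub_le : ∀ i x z w,
    |F (Function.update x i z) - F (Function.update x i w)| ≤ β * ‖z - w‖

namespace MixedLipschitz

variable {n : ℕ} {E : Type*} [NormedAddCommGroup E] {α β : ℝ} {F : (Fin n → E) → ℝ}

lemma comp (hF : MixedLipschitz α β F) {φ : ℝ → ℝ} (hφ : ∀ s t, |φ s - φ t| ≤ |s - t|) :
    MixedLipschitz α β fun x => φ (F x) :=
  ⟨fun x y => (hφ _ _).trans (hF.abs_sub_le x y),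
    fun i x z w => (hφ _ _).trans (hF.abs_update_sub_le i x z w)⟩

lemma neg (hF : MixedLipschitz α β F) : MixedLipschitz α β fun x => -F x :=
  hF.comp fun s t => by rw [neg_sub_neg, abs_sub_comm]

/-- The metric on the product is the supremum metric, whence the factor `√n`. Only continuity and
uniform continuity are drawn from this. -/
lemma lipschitzWith (hF : MixedLipschitz α β F) (hα : 0 ≤ α) :
    LipschitzWith (α * √n).toNNReal F := by
  refine LipschitzWith.of_dist_le_mul fun x y => ?_
  rw [Real.coe_toNNReal _ (by positivity), Real.dist_eq, mul_assoc]
  refine (hF.abs_sub_le x y).trans (mul_le_mul_of_nonneg_left ?_ hα)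
  rw [← Real.sqrt_sq (dist_nonneg (x := x) (y := y)), ← Real.sqrt_mul (by positivity)]
  refine Real.sqrt_le_sqrt ?_
  calc ∑ i, ‖x i - y i‖ ^ 2 ≤ ∑ _i : Fin n, dist x y ^ 2 := by
        refine Finset.sum_le_sum fun i _ => pow_le_pow_left₀ (norm_nonneg _) ?_ 2
        rw [← dist_eq_norm]
        exact dist_le_pi_dist x y i
    _ = n * dist x y ^ 2 := by simp

variable [InnerProductSpace ℝ E]

lemma norm_fderiv_update_le (hF : MixedLipschitz α β F) (hβ : 0 ≤ β) (i : Fin n) (x : Fin n → E)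
    (z : E) : ‖fderiv ℝ (fun z => F (Function.update x i z)) z‖ ≤ β := by
  have : LipschitzWith β.toNNReal fun z => F (Function.update x i z) :=
    LipschitzWith.of_dist_le_mul fun z w => by
      rw [Real.coe_toNNReal _ hβ, Real.dist_eq, dist_eq_norm]
      exact hF.abs_update_sub_le i x z w
  simpa [hβ] using norm_fderiv_le_of_lipschitz ℝ this

lemma fderiv_update_eq (hc : ContDiff ℝ 1 F) (i : Fin n) (x : Fin n → E) (z : E) :
    fderiv ℝ (fun z => F (Function.update x i z)) z =
      (fderiv ℝ F (Function.update x i z)).comp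
        (ContinuousLinearMap.single ℝ (fun _ : Fin n => E) i) := by
  have h1 := (hc.differentiable one_ne_zero (Function.update x i z)).hasFDerivAt
  have h2 := h1.comp z (hasFDerivAt_update x z)
  refine h2.fderiv.trans ?_
  congr 1
  ext w j
  by_cases hj : j = i
  · subst hj; simp
  · simp [hj]

/-- Differentiate along the vector `w` of Riesz representatives of the partial derivatives. The
derivative is the sum of squares `S` and `w` has Euclidean length `√S`, so the Lipschitz bound reads
`S ≤ α √S`. -/
lemma sum_sq_norm_fderiv_le [CompleteSpace E] (hF : MixedLipschitz α β F) (hα : 0 ≤ α)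
    (hc : ContDiff ℝ 1 F) (x : Fin n → E) :
    ∑ i, ‖(fderiv ℝ F x).comp (ContinuousLinearMap.single ℝ (fun _ : Fin n => E) i)‖ ^ 2 ≤
      α ^ 2 := by
  set D : Fin n → E →L[ℝ] ℝ := fun i =>
    (fderiv ℝ F x).comp (ContinuousLinearMap.single ℝ (fun _ : Fin n => E) i) with hD
  set w : Fin n → E := fun i => (InnerProductSpace.toDual ℝ E).symm (D i) with hw
  have hwn : ∀ i, ‖w i‖ = ‖D i‖ := fun i => LinearIsometryEquiv.norm_map _ _
  set S := ∑ i, ‖D i‖ ^ 2 with hS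
  have hval : fderiv ℝ F x w = S := by
    have e : w = ∑ i, Pi.single i (w i) := (Finset.univ_sum_single w).symm
    conv_lhs => rw [e, map_sum]
    refine Finset.sum_congr rfl fun i _ => ?_
    have h1 : (fderiv ℝ F x) (Pi.single i (w i)) = D i (w i) := by simp [hD]
    have h2 : D i (w i) = inner ℝ (w i) (w i) :=
      (InnerProductSpace.toDual_symm_apply (y := D i)).symm
    rw [h1, h2, real_inner_self_eq_norm_sq, hwn]
  have hS0 : 0 ≤ S := Finset.sum_nonneg fun i _ => by positivity
  have hder : HasDerivAt (fun t : ℝ => F (x + t • w)) S 0 := by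
    have h1 : HasFDerivAt F (fderiv ℝ F x) (x + (0 : ℝ) • w) := by
      simpa using (hc.differentiable one_ne_zero x).hasFDerivAt
    have h2 : HasDerivAt (fun t : ℝ => x + t • w) w 0 := by
      simpa using ((hasDerivAt_id (0 : ℝ)).smul_const w).const_add x
    rw [← hval]
    exact h1.comp_hasDerivAt 0 h2
  have hlip : LipschitzWith (α * √S).toNNReal fun t : ℝ => F (x + t • w) := by
    refine LipschitzWith.of_dist_le_mul fun s t => ?_
    rw [Real.coe_toNNReal _ (by positivity), Real.dist_eq, Real.dist_eq]
    refine (hF.abs_sub_le _ _).trans_eq ?_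
    have : ∀ i, ‖(x + s • w) i - (x + t • w) i‖ ^ 2 = (s - t) ^ 2 * ‖D i‖ ^ 2 := fun i => by
      simp only [Pi.add_apply, Pi.smul_apply, add_sub_add_left_eq_sub]
      rw [← sub_smul, norm_smul, mul_pow, hwn, Real.norm_eq_abs, sq_abs]
    simp_rw [this]
    rw [← Finset.mul_sum, ← hS, Real.sqrt_mul (sq_nonneg _), Real.sqrt_sq_eq_abs]
    ring
  have h3 : S ≤ α * √S := by
    have := norm_deriv_le_of_lipschitz (x₀ := 0) hlip
    rw [hder.deriv, Real.coe_toNNReal _ (by positivity)] at this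
    exact (le_abs_self _).trans this
  have h4 := Real.sq_sqrt hS0
  have h5 := Real.sqrt_nonneg S
  have h6 : √S ≤ α := by
    by_contra! hlt
    nlinarith
  rw [← h4]
  exact pow_le_pow_left₀ h5 h6 2

end MixedLipschitz

/-! ### Exponential moments for bounded mixed Lipschitz functions. -/

section Concentration

variable {d n : ℕ} {μ : Measure (EuclideanSpace ℝ (Fin d))} [IsProbabilityMeasure μ] {M α β : ℝ}
  {F : (Fin n → EuclideanSpace ℝ (Fin d)) → ℝ}

/-- Here the two constants separate: `β` makes the one-variable logarithmic Sobolev inequality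
applicable to `s F`, and `α` bounds the sum of the resulting gradient terms. -/
lemma MixedLipschitz.entExp_pi_le (hM : 0 < M) (hP : Poincare M μ) (hF : MixedLipschitz α β F)
    (hα : 0 ≤ α) (hβ : 0 ≤ β) (hc : ContDiff ℝ 1 F) {R : ℝ} (hR : ∀ x, |F x| ≤ R) {s : ℝ}
    (hs : 0 < s) (hsβ : M * (s * β) ^ 2 ≤ 1 / 20) :
    entExp (Measure.pi fun _ : Fin n => μ) (fun x => s * F x) ≤
      7 * M * α ^ 2 * s ^ 2 * ∫ x, Real.exp (s * F x) ∂(Measure.pi fun _ : Fin n => μ) := by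
  have hFm : Measurable F := hc.continuous.measurable
  set D : Fin n → (Fin n → EuclideanSpace ℝ (Fin d)) → ℝ := fun i x =>
    ‖(fderiv ℝ F x).comp (ContinuousLinearMap.single ℝ (fun _ => EuclideanSpace ℝ (Fin d)) i)‖
    with hD
  have hDm : ∀ i, Measurable (D i) := fun i =>
    ((hc.continuous_fderiv one_ne_zero).clm_comp continuous_const).norm.measurable
  have hDu : ∀ i x z, D i (Function.update x i z) =
      ‖fderiv ℝ (fun z => F (Function.update x i z)) z‖ := fun i x z => by
    rw [MixedLipschitz.fderiv_update_eq hc]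
  have hDβ : ∀ i x, D i x ≤ β := fun i x => by
    have := hF.norm_fderiv_update_le hβ i x (x i)
    rwa [← hDu, Function.update_eq_self] at this
  have hsb : ∀ x, |s * F x| ≤ s * R := fun x => by
    rw [abs_mul, abs_of_pos hs]; exact mul_le_mul_of_nonneg_left (hR x) hs.le
  have hDb : ∀ i x, |7 * M * (s * D i x) ^ 2| ≤ 7 * M * (s * β) ^ 2 := fun i x => by
    have h0 : 0 ≤ D i x := norm_nonneg _
    rw [abs_of_nonneg (by positivity)]
    gcongr
    exact hDβ i x
  have hmain := ProjOT.entExp_pi_le (μ := μ) (hFm.const_mul s) hsb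
    (H := fun i x => 7 * M * (s * D i x) ^ 2 * Real.exp (s * F x))
    (fun i => by have := hDm i; fun_prop) (fun i x => abs_mul_exp_le (hDb i x) (hsb x))
    fun i x => by
      have hcu : ContDiff ℝ 1 fun z => F (Function.update x i z) := hc.comp (contDiff_update 1 x i)
      have hfd : ∀ z, fderiv ℝ (fun z => s * F (Function.update x i z)) z =
          s • fderiv ℝ (fun z => F (Function.update x i z)) z := fun z =>
        ((hcu.differentiable one_ne_zero z).hasFDerivAt.const_mul s).fderiv
      have hn : ∀ z, ‖fderiv ℝ (fun z => s * F (Function.update x i z)) z‖ =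
          s * D i (Function.update x i z) := fun z => by
        rw [hfd, norm_smul, hDu, Real.norm_eq_abs, abs_of_pos hs]
      have h := hP.entExp_le hM (contDiff_const.mul hcu) (c := s * β)
        (fun z => hsb (Function.update x i z))
        (fun z => by rw [hn]; exact mul_le_mul_of_nonneg_left (hDβ _ _) hs.le) hsβ
      simp_rw [hn, ← integral_const_mul, ← mul_assoc] at h
      exact h
  refine hmain.trans ?_
  have hi : ∀ i, Integrable (fun x => 7 * M * (s * D i x) ^ 2 * Real.exp (s * F x))
      (Measure.pi fun _ : Fin n => μ) := fun i =>
    integrable_mul_exp_of_abs_le (by have := hDm i; fun_prop) (hFm.const_mul s) (hDb i) hsb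
  rw [← integral_finsetSum _ fun i _ => hi i, ← integral_const_mul]
  refine integral_mono (integrable_finsetSum _ fun i _ => hi i)
    ((integrable_exp_of_abs_le (hFm.const_mul s) hsb).const_mul _) fun x => ?_
  dsimp only
  rw [← Finset.sum_mul]
  refine mul_le_mul_of_nonneg_right ?_ (Real.exp_pos _).le
  simp_rw [mul_pow]
  rw [← Finset.mul_sum, ← Finset.mul_sum]
  have := hF.sum_sq_norm_fderiv_le hα hc x
  calc 7 * M * (s ^ 2 * ∑ i, D i x ^ 2) ≤ 7 * M * (s ^ 2 * α ^ 2) := by gcongr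
    _ = _ := by ring

lemma MixedLipschitz.integral_exp_le_of_contDiff (hM : 0 < M) (hP : Poincare M μ)
    (hF : MixedLipschitz α β F) (hα : 0 ≤ α) (hβ : 0 ≤ β) (hc : ContDiff ℝ 1 F) {R : ℝ}
    (hR : ∀ x, |F x| ≤ R) {s : ℝ} (hs : 0 < s) (hsβ : M * (s * β) ^ 2 ≤ 1 / 20) :
    ∫ x, Real.exp (s * F x) ∂(Measure.pi fun _ : Fin n => μ) ≤
      Real.exp (s * ∫ x, F x ∂(Measure.pi fun _ : Fin n => μ) + 7 * M * α ^ 2 * s ^ 2) := by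
  refine integral_exp_le_of_entExp_le hc.continuous.measurable hR (b := s)
    (fun r hr hrs => hF.entExp_pi_le hM hP hα hβ hc hR hr (le_trans ?_ hsβ)) hs le_rfl
  gcongr

/-- Approximation by smooth functions with the same Lipschitz constants. -/
lemma MixedLipschitz.exists_contDiff (hF : MixedLipschitz α β F) (hα : 0 ≤ α) {ε : ℝ}
    (hε : 0 < ε) : ∃ G : (Fin n → EuclideanSpace ℝ (Fin d)) → ℝ,
      ContDiff ℝ 1 G ∧ MixedLipschitz α β G ∧ ∀ x, |G x - F x| ≤ ε := by
  have hlip := hF.lipschitzWith hα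
  have hcont := hlip.continuous
  obtain ⟨δ, hδ, hδF⟩ := Metric.uniformContinuous_iff.1 hlip.uniformContinuous ε hε
  set ν : Measure (Fin n → EuclideanSpace ℝ (Fin d)) := Measure.addHaar with hν
  set φ : ContDiffBump (0 : Fin n → EuclideanSpace ℝ (Fin d)) :=
    ⟨δ / 2, δ, half_pos hδ, half_lt_self hδ⟩ with hφ
  set G := convolution (φ.normed ν) F (ContinuousLinearMap.lsmul ℝ ℝ) ν with hG
  have hGx : ∀ x, G x = ∫ t, φ.normed ν t * F (x - t) ∂ν := fun x => by
    rw [hG, convolution_def]; simp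
  have hφi : Integrable (φ.normed ν) ν := φ.integrable_normed
  have hint : ∀ x, Integrable (fun t => φ.normed ν t * F (x - t)) ν := fun x => by
    refine Continuous.integrable_of_hasCompactSupport
      (φ.continuous_normed.mul (hcont.comp (continuous_const.sub continuous_id))) ?_
    exact φ.hasCompactSupport_normed.mul_right
  -- `G` is an average of translates of `F`, so any bound on differences that is uniform over
  -- translations passes to `G`; both Lipschitz conditions are of this kind.
  have hdiff : ∀ x y C, (∀ t, |F (x - t) - F (y - t)| ≤ C) → |G x - G y| ≤ C := by
    intro x y C hC
    rw [hGx, hGx, ← integral_sub (hint x) (hint y)]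
    calc |∫ t, (φ.normed ν t * F (x - t) - φ.normed ν t * F (y - t)) ∂ν|
        ≤ ∫ t, φ.normed ν t * C ∂ν := by
          rw [← Real.norm_eq_abs]
          refine norm_integral_le_of_norm_le (hφi.mul_const C)
            (Filter.Eventually.of_forall fun t => ?_)
          rw [← mul_sub, Real.norm_eq_abs, abs_mul, abs_of_nonneg (φ.nonneg_normed t)]
          exact mul_le_mul_of_nonneg_left (hC t) (φ.nonneg_normed t)
      _ = C := by rw [integral_mul_const, φ.integral_normed, one_mul]
  refine ⟨G, ?_, ⟨fun x y => hdiff x y _ fun t => ?_, fun i x z w => hdiff _ _ _ fun t => ?_⟩,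
    fun x => ?_⟩
  · exact φ.hasCompactSupport_normed.contDiff_convolution_left (n := 1) _ φ.contDiff_normed
      (hcont.locallyIntegrable (μ := ν))
  · simpa using hF.abs_sub_le (x - t) (y - t)
  · have e : ∀ z, Function.update x i z - t = Function.update (x - t) i (z - t i) := fun z => by
      ext1 j
      by_cases hj : j = i
      · subst hj; simp
      · simp [hj]
    rw [e, e]
    simpa using hF.abs_update_sub_le i (x - t) (z - t i) (w - t i)
  · exact φ.dist_normed_convolution_le hcont.aestronglyMeasurable fun y hy => (hδF hy).le

/-- A smooth `G` within `ε` of `F` costs a factor `exp (s ε)` in the exponential moment and another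
in the mean; let `ε` tend to `0`. -/
lemma MixedLipschitz.integral_exp_le_of_bounded (hM : 0 < M) (hP : Poincare M μ)
    (hF : MixedLipschitz α β F) (hα : 0 ≤ α) (hβ : 0 ≤ β) {R : ℝ}
    (hR : ∀ x, |F x| ≤ R) {s : ℝ} (hs : 0 < s) (hsβ : M * (s * β) ^ 2 ≤ 1 / 20) :
    ∫ x, Real.exp (s * F x) ∂(Measure.pi fun _ : Fin n => μ) ≤
      Real.exp (s * ∫ x, F x ∂(Measure.pi fun _ : Fin n => μ) + 7 * M * α ^ 2 * s ^ 2) := by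
  set ρ := Measure.pi fun _ : Fin n => μ with hρ
  have hFm : Measurable F := (hF.lipschitzWith hα).continuous.measurable
  have key : ∀ ε : ℝ, 0 < ε → ∫ x, Real.exp (s * F x) ∂ρ ≤
      Real.exp (2 * s * ε + (s * ∫ x, F x ∂ρ + 7 * M * α ^ 2 * s ^ 2)) := by
    intro ε hε
    obtain ⟨G, hGc, hGL, hGF⟩ := hF.exists_contDiff hα hε
    have hGm : Measurable G := hGc.continuous.measurable
    have hGR : ∀ x, |G x| ≤ R + ε := fun x => by
      have h1 := hGF x; have h2 := hR x
      rw [abs_le] at *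
      constructor <;> linarith
    have h1 := hGL.integral_exp_le_of_contDiff hM hP hα hβ hGc hGR hs hsβ
    have hb : ∀ {f : (Fin n → EuclideanSpace ℝ (Fin d)) → ℝ} {r : ℝ}, (∀ x, |f x| ≤ r) →
        ∀ x, |s * f x| ≤ s * r := fun hf x => by
      rw [abs_mul, abs_of_pos hs]; exact mul_le_mul_of_nonneg_left (hf x) hs.le
    have h2 : ∫ x, Real.exp (s * F x) ∂ρ ≤ Real.exp (s * ε) * ∫ x, Real.exp (s * G x) ∂ρ := by
      rw [← integral_const_mul]
      refine integral_mono (integrable_exp_of_abs_le (hFm.const_mul s) (hb hR))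
        ((integrable_exp_of_abs_le (hGm.const_mul s) (hb hGR)).const_mul _) fun x => ?_
      dsimp only
      rw [← Real.exp_add, ← mul_add]
      refine Real.exp_le_exp.2 (mul_le_mul_of_nonneg_left ?_ hs.le)
      linarith [(abs_le.1 (hGF x)).1]
    have h3 : ∫ x, G x ∂ρ ≤ ∫ x, F x ∂ρ + ε := by
      have : ∫ x, G x ∂ρ ≤ ∫ x, (F x + ε) ∂ρ :=
        integral_mono (integrable_of_abs_le hGm hGR)
          ((integrable_of_abs_le hFm hR).add (integrable_const ε)) fun x => by
            have := (abs_le.1 (hGF x)).2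
            dsimp only
            linarith
      rwa [integral_add (integrable_of_abs_le hFm hR) (integrable_const ε), integral_const,
        probReal_univ, one_smul] at this
    refine h2.trans ((mul_le_mul_of_nonneg_left h1 (Real.exp_pos _).le).trans ?_)
    rw [← Real.exp_add]
    refine Real.exp_le_exp.2 ?_
    have := mul_le_mul_of_nonneg_left h3 hs.le
    linarith
  have hlim : Filter.Tendsto
      (fun ε : ℝ => Real.exp (2 * s * ε + (s * ∫ x, F x ∂ρ + 7 * M * α ^ 2 * s ^ 2)))
      (nhdsWithin 0 (Set.Ioi 0))
      (nhds (Real.exp (2 * s * 0 + (s * ∫ x, F x ∂ρ + 7 * M * α ^ 2 * s ^ 2)))) :=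
    (Continuous.tendsto (by fun_prop) 0).mono_left nhdsWithin_le_nhds
  rw [mul_zero, zero_add] at hlim
  exact ge_of_tendsto hlim (eventually_mem_nhdsWithin.mono fun ε hε => key ε hε)

end Concentration

end ProjOT

/-! ### Unbounded functions, tail bounds and moments. -/

namespace ProjOT

section Concentration

variable {d n : ℕ} {μ : Measure (EuclideanSpace ℝ (Fin d))} [IsProbabilityMeasure μ] {M α β : ℝ}
  {F : (Fin n → EuclideanSpace ℝ (Fin d)) → ℝ}

/-- The point is to bound the means of the truncations `min |F| N` uniformly in `N`. The moment
bound for their negatives does it: `E exp (-s |F|) > 0` is a lower bound independent of `N`, so the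
means cannot grow. The moment bound for the truncations themselves and Fatou's lemma finish. -/
lemma MixedLipschitz.integrable_exp_abs (hM : 0 < M) (hP : Poincare M μ)
    (hF : MixedLipschitz α β F) (hα : 0 ≤ α) (hβ : 0 ≤ β) {s : ℝ} (hs : 0 < s)
    (hsβ : M * (s * β) ^ 2 ≤ 1 / 20) :
    Integrable (fun x => Real.exp (s * |F x|)) (Measure.pi fun _ : Fin n => μ) := by
  set ρ := Measure.pi fun _ : Fin n => μ with hρ
  have hFm : Measurable F := (hF.lipschitzWith hα).continuous.measurable
  set G : ℕ → (Fin n → EuclideanSpace ℝ (Fin d)) → ℝ := fun N x => min |F x| N with hG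
  have hGL : ∀ N, MixedLipschitz α β (G N) := fun N =>
    hF.comp (φ := fun t => min |t| N) fun a b => by
      refine (abs_min_sub_min_le_max _ _ _ _).trans ?_
      rw [sub_self, abs_zero, max_eq_left (abs_nonneg _)]
      exact abs_abs_sub_abs_le a b
  have hG0 : ∀ N x, 0 ≤ G N x := fun N x => le_min (abs_nonneg _) (Nat.cast_nonneg _)
  have hGF : ∀ N x, G N x ≤ |F x| := fun N x => min_le_left _ _
  have hGR : ∀ N x, |G N x| ≤ N := fun N x => by
    rw [abs_of_nonneg (hG0 N x)]; exact min_le_right _ _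
  have hGm : ∀ N, Measurable (G N) := fun N => hFm.abs.min measurable_const
  set κ := 7 * M * α ^ 2 * s ^ 2 with hκ
  have i0 : Integrable (fun x => Real.exp (-(s * |F x|))) ρ :=
    integrable_of_abs_le (by fun_prop) (R := 1) fun x => by
      rw [Real.abs_exp, Real.exp_le_one_iff, neg_nonpos]
      positivity
  set b := ∫ x, Real.exp (-(s * |F x|)) ∂ρ with hb
  have hbpos : 0 < b := integral_exp_pos i0
  have hB : ∀ N, ∫ x, Real.exp (s * G N x) ∂ρ ≤ Real.exp (2 * κ - Real.log b) := by
    intro N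
    have h1 := (hGL N).neg.integral_exp_le_of_bounded hM hP hα hβ (R := N)
      (fun x => by rw [abs_neg]; exact hGR N x) hs hsβ
    have h2 := (hGL N).integral_exp_le_of_bounded hM hP hα hβ (hGR N) hs hsβ
    rw [integral_neg, ← hρ, ← hκ] at h1
    rw [← hρ, ← hκ] at h2
    have h3 : b ≤ ∫ x, Real.exp (s * -G N x) ∂ρ := by
      refine integral_mono i0 (integrable_of_abs_le (by have := hGm N; fun_prop) (R := 1)
        fun x => ?_) fun x => ?_
      · rw [Real.abs_exp, Real.exp_le_one_iff, mul_neg, neg_nonpos]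
        exact mul_nonneg hs.le (hG0 N x)
      · refine Real.exp_le_exp.2 ?_
        have := mul_le_mul_of_nonneg_left (hGF N x) hs.le
        linarith
    have h4 := (Real.log_le_iff_le_exp hbpos).2 (h3.trans h1)
    exact h2.trans (Real.exp_le_exp.2 (by linarith))
  refine ⟨by fun_prop, ?_⟩
  rw [hasFiniteIntegral_iff_ofReal (Filter.Eventually.of_forall fun x => (Real.exp_pos _).le)]
  have hlim : ∀ x, Filter.Tendsto (fun N => ENNReal.ofReal (Real.exp (s * G N x))) Filter.atTop
      (nhds (ENNReal.ofReal (Real.exp (s * |F x|)))) := fun x => by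
    refine tendsto_const_nhds.congr' ?_
    obtain ⟨N, hN⟩ := exists_nat_ge |F x|
    filter_upwards [Filter.eventually_ge_atTop N] with k hk
    rw [hG]
    dsimp only
    rw [min_eq_left (hN.trans (Nat.cast_le.2 hk))]
  calc ∫⁻ x, ENNReal.ofReal (Real.exp (s * |F x|)) ∂ρ
      = ∫⁻ x, Filter.liminf (fun N => ENNReal.ofReal (Real.exp (s * G N x))) Filter.atTop ∂ρ := by
        simp_rw [(hlim _).liminf_eq]
    _ ≤ Filter.liminf (fun N => ∫⁻ x, ENNReal.ofReal (Real.exp (s * G N x)) ∂ρ) Filter.atTop :=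
        lintegral_liminf_le fun N => by have := hGm N; fun_prop
    _ ≤ Filter.liminf (fun _ : ℕ => ENNReal.ofReal (Real.exp (2 * κ - Real.log b)))
          Filter.atTop := by
        refine Filter.liminf_le_liminf (Filter.Eventually.of_forall fun N => ?_)
        rw [← ofReal_integral_eq_lintegral_ofReal (integrable_exp_of_abs_le
          ((hGm N).const_mul s) (R := s * N) fun x => by
            rw [abs_mul, abs_of_pos hs]; exact mul_le_mul_of_nonneg_left (hGR N x) hs.le)
          (Filter.Eventually.of_forall fun x => (Real.exp_pos _).le)]
        exact ENNReal.ofReal_le_ofReal (hB N)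
    _ < ∞ := by rw [Filter.liminf_const]; exact ENNReal.ofReal_lt_top

lemma exists_pos_mul_sq_le (hM : 0 < M) (β : ℝ) : ∃ s : ℝ, 0 < s ∧ M * (s * β) ^ 2 ≤ 1 / 20 := by
  refine ⟨√(1 / (20 * M * (β ^ 2 + 1))), by positivity, ?_⟩
  rw [mul_pow, Real.sq_sqrt (by positivity), ← mul_assoc, mul_one_div, div_mul_eq_mul_div,
    div_le_iff₀ (by positivity)]
  nlinarith

lemma MixedLipschitz.integrable (hM : 0 < M) (hP : Poincare M μ)
    (hF : MixedLipschitz α β F) (hα : 0 ≤ α) (hβ : 0 ≤ β) :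
    Integrable F (Measure.pi fun _ : Fin n => μ) := by
  obtain ⟨s, hs, hsβ⟩ := exists_pos_mul_sq_le hM β
  refine ((hF.integrable_exp_abs hM hP hα hβ hs hsβ).const_mul s⁻¹).mono'
    (hF.lipschitzWith hα).continuous.aestronglyMeasurable (Filter.Eventually.of_forall fun x => ?_)
  rw [Real.norm_eq_abs, ← div_eq_inv_mul, le_div_iff₀ hs]
  linarith [Real.add_one_le_exp (s * |F x|)]

/-- Exponential moments of functions on a product of measures with a Poincaré inequality. -/
lemma MixedLipschitz.integral_exp_le (hM : 0 < M) (hP : Poincare M μ)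
    (hF : MixedLipschitz α β F) (hα : 0 ≤ α) (hβ : 0 ≤ β) {s : ℝ} (hs : 0 < s)
    (hsβ : M * (s * β) ^ 2 ≤ 1 / 20) :
    ∫ x, Real.exp (s * F x) ∂(Measure.pi fun _ : Fin n => μ) ≤
      Real.exp (s * ∫ x, F x ∂(Measure.pi fun _ : Fin n => μ) + 7 * M * α ^ 2 * s ^ 2) := by
  set ρ := Measure.pi fun _ : Fin n => μ with hρ
  have hFm : Measurable F := (hF.lipschitzWith hα).continuous.measurable
  -- Two-sided truncation keeps both Lipschitz constants; dominated convergence applies with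
  -- majorants `|F|` and `exp (s |F|)`.
  set G : ℕ → (Fin n → EuclideanSpace ℝ (Fin d)) → ℝ := fun N x => max (-N) (min (F x) N) with hG
  have hGL : ∀ N, MixedLipschitz α β (G N) := fun N =>
    hF.comp (φ := fun t => max (-N) (min t N)) fun a b => by
      refine (abs_max_sub_max_le_max _ _ _ _).trans ?_
      rw [sub_self, abs_zero, max_eq_right (abs_nonneg _)]
      refine (abs_min_sub_min_le_max _ _ _ _).trans ?_
      rw [sub_self, abs_zero, max_eq_left (abs_nonneg _)]
  have hGm : ∀ N, Measurable (G N) := fun N => measurable_const.max (hFm.min measurable_const)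
  have hGR : ∀ N x, |G N x| ≤ N := fun N x =>
    abs_le.2 ⟨le_max_left _ _, max_le (by linarith [Nat.cast_nonneg (α := ℝ) N]) (min_le_right _ _)⟩
  have hGF : ∀ N x, |G N x| ≤ |F x| := fun N x => by
    have h0 := Nat.cast_nonneg (α := ℝ) N
    rw [hG]
    rcases le_total (F x) N with h1 | h1
    · rcases le_total (-(N : ℝ)) (F x) with h2 | h2
      · simp [h1, h2]
      · simp only [min_eq_left h1, max_eq_left h2, abs_neg]
        rw [abs_of_nonneg h0, abs_of_nonpos (by linarith)]
        linarith
    · simp only [min_eq_right h1]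
      rw [max_eq_right (by linarith), abs_of_nonneg h0, abs_of_nonneg (by linarith)]
      exact h1
  have hlim : ∀ x, Filter.Tendsto (fun N => G N x) Filter.atTop (nhds (F x)) := fun x => by
    refine tendsto_const_nhds.congr' ?_
    obtain ⟨N, hN⟩ := exists_nat_ge |F x|
    filter_upwards [Filter.eventually_ge_atTop N] with k hk
    have h1 := abs_le.1 (hN.trans (Nat.cast_le.2 hk))
    rw [hG]
    dsimp only
    rw [min_eq_left h1.2, max_eq_right h1.1]
  have l1 : Filter.Tendsto (fun N => ∫ x, G N x ∂ρ) Filter.atTop (nhds (∫ x, F x ∂ρ)) :=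
    tendsto_integral_of_dominated_convergence (fun x => |F x|)
      (fun N => (hGm N).aestronglyMeasurable) (hF.integrable hM hP hα hβ).abs
      (fun N => Filter.Eventually.of_forall fun x => hGF N x) (Filter.Eventually.of_forall hlim)
  have l2 : Filter.Tendsto (fun N => ∫ x, Real.exp (s * G N x) ∂ρ) Filter.atTop
      (nhds (∫ x, Real.exp (s * F x) ∂ρ)) :=
    tendsto_integral_of_dominated_convergence (fun x => Real.exp (s * |F x|))
      (fun N => by have := hGm N; fun_prop) (hF.integrable_exp_abs hM hP hα hβ hs hsβ)
      (fun N => Filter.Eventually.of_forall fun x => by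
        rw [Real.norm_eq_abs, Real.abs_exp]
        exact Real.exp_le_exp.2 (mul_le_mul_of_nonneg_left
          ((le_abs_self _).trans (hGF N x)) hs.le))
      (Filter.Eventually.of_forall fun x =>
        (Real.continuous_exp.tendsto _).comp ((hlim x).const_mul s))
  exact le_of_tendsto_of_tendsto' l2
    ((Real.continuous_exp.tendsto _).comp ((l1.const_mul s).add_const _)) fun N =>
      (hGL N).integral_exp_le_of_bounded hM hP hα hβ (hGR N) hs hsβ

lemma MixedLipschitz.measureReal_ge_le (hM : 0 < M) (hP : Poincare M μ)
    (hF : MixedLipschitz α β F) (hα : 0 ≤ α) (hβ : 0 ≤ β) {s : ℝ} (hs : 0 < s)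
    (hsβ : M * (s * β) ^ 2 ≤ 1 / 20) (t : ℝ) :
    (Measure.pi fun _ : Fin n => μ).real
      {x | t ≤ F x - ∫ y, F y ∂(Measure.pi fun _ : Fin n => μ)} ≤
      Real.exp (-(s * t) + 7 * M * α ^ 2 * s ^ 2) := by
  set ρ := Measure.pi fun _ : Fin n => μ with hρ
  set m := ∫ y, F y ∂ρ with hm
  have hFm : Measurable F := (hF.lipschitzWith hα).continuous.measurable
  have hi : Integrable (fun x => Real.exp (s * F x)) ρ :=
    (hF.integrable_exp_abs hM hP hα hβ hs hsβ).mono' (by fun_prop)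
      (Filter.Eventually.of_forall fun x => by
        rw [Real.norm_eq_abs, Real.abs_exp]
        exact Real.exp_le_exp.2 (mul_le_mul_of_nonneg_left (le_abs_self _) hs.le))
  have h1 := measure_ge_le_exp_mul_mgf (X := F) (μ := ρ) (t + m) hs.le hi
  have h2 : mgf F ρ s ≤ _ := hF.integral_exp_le hM hP hα hβ hs hsβ
  have e : {x | t ≤ F x - m} = {x | t + m ≤ F x} := by
    ext x; exact le_sub_iff_add_le (a := t) (b := m) (c := F x)
  rw [e]
  refine h1.trans ((mul_le_mul_of_nonneg_left h2 (Real.exp_pos _).le).trans_eq ?_)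
  rw [← Real.exp_add]
  congr 1
  ring

/-- The constant of the concentration inequality. -/
noncomputable def concentrationConst (M : ℝ) : ℝ := max (28 * M) (2 * √(20 * M))

lemma concentrationConst_pos (hM : 0 < M) : 0 < concentrationConst M :=
  lt_max_of_lt_left (by positivity)

lemma MixedLipschitz.measureReal_ge_le_exp_min (hM : 0 < M) (hP : Poincare M μ)
    (hF : MixedLipschitz α β F) (hα : 0 < α) (hβ : 0 < β) {t : ℝ} (ht : 0 < t) :
    (Measure.pi fun _ : Fin n => μ).real
      {x | t ≤ F x - ∫ y, F y ∂(Measure.pi fun _ : Fin n => μ)} ≤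
      Real.exp (-((concentrationConst M)⁻¹ * min (t / β) (t ^ 2 / α ^ 2))) := by
  set K := concentrationConst M with hK
  have hKpos : 0 < K := concentrationConst_pos hM
  have hr : 0 < √(20 * M) := by positivity
  have hr2 : √(20 * M) ^ 2 = 20 * M := Real.sq_sqrt (by positivity)
  -- The minimiser `t / (14 M α²)` of the Chernoff exponent, capped by the largest admissible `s`.
  -- The exponent is then at most `-s t / 2`, and the two cases yield the constants `28 M` and `2
  -- √(20 M)`.
  set s := min ((√(20 * M))⁻¹ / β) (t / (14 * M * α ^ 2)) with hs
  have hs0 : 0 < s := lt_min (by positivity) (by positivity)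
  have hsβ : s * β ≤ (√(20 * M))⁻¹ := (le_div_iff₀ hβ).1 (min_le_left _ _)
  have hsα : s * (14 * M * α ^ 2) ≤ t := (le_div_iff₀ (by positivity)).1 (min_le_right _ _)
  have hcond : M * (s * β) ^ 2 ≤ 1 / 20 := by
    calc M * (s * β) ^ 2 ≤ M * (√(20 * M))⁻¹ ^ 2 := by gcongr
      _ = 1 / 20 := by rw [inv_pow, hr2]; field_simp
  refine (hF.measureReal_ge_le hM hP hα.le hβ.le hs0 hcond t).trans (Real.exp_le_exp.2 ?_)
  have h1 : -(s * t) + 7 * M * α ^ 2 * s ^ 2 ≤ -(s * t / 2) := by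
    have := mul_le_mul_of_nonneg_left hsα hs0.le
    linarith
  refine h1.trans (neg_le_neg ?_)
  rw [inv_mul_le_iff₀ hKpos]
  rcases min_choice ((√(20 * M))⁻¹ / β) (t / (14 * M * α ^ 2)) with h | h
  · refine (min_le_left _ _).trans ?_
    rw [hs, h]
    have : 2 * √(20 * M) ≤ K := le_max_right _ _
    calc t / β = 2 * √(20 * M) * ((√(20 * M))⁻¹ / β * t / 2) := by field_simp
      _ ≤ _ := by gcongr
  · refine (min_le_right _ _).trans ?_
    rw [hs, h]
    have : 28 * M ≤ K := le_max_left _ _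
    calc t ^ 2 / α ^ 2 = 28 * M * (t / (14 * M * α ^ 2) * t / 2) := by field_simp; norm_num
      _ ≤ _ := by gcongr

/-- Two-sided concentration of functions of independent variables whose law satisfies a Poincaré
inequality. -/
theorem MixedLipschitz.measureReal_abs_ge_le (hM : 0 < M) (hP : Poincare M μ)
    (hF : MixedLipschitz α β F) (hα : 0 < α) (hβ : 0 < β) (t : ℝ) :
    (Measure.pi fun _ : Fin n => μ).real
      {x | t ≤ |F x - ∫ y, F y ∂(Measure.pi fun _ : Fin n => μ)|} ≤
      2 * Real.exp (-((concentrationConst M)⁻¹ * min (t / β) (t ^ 2 / α ^ 2))) := by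
  rcases le_or_gt t 0 with ht | ht
  · refine measureReal_le_one.trans ?_
    have : (concentrationConst M)⁻¹ * min (t / β) (t ^ 2 / α ^ 2) ≤ 0 :=
      mul_nonpos_of_nonneg_of_nonpos (inv_nonneg.2 (concentrationConst_pos hM).le)
        (min_le_of_left_le (div_nonpos_of_nonpos_of_nonneg ht hβ.le))
    have := Real.one_le_exp (neg_nonneg.2 this)
    linarith
  · have h1 := hF.measureReal_ge_le_exp_min hM hP hα hβ ht
    have h2 := hF.neg.measureReal_ge_le_exp_min hM hP hα hβ ht
    rw [two_mul]
    refine (measureReal_mono ?_).trans ((measureReal_union_le _ _).trans (add_le_add h1 h2))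
    intro x hx
    rcases le_abs.1 (show t ≤ |F x - _| from hx) with h | h
    · exact Or.inl h
    · right
      show t ≤ -F x - ∫ y, -F y ∂_
      rw [integral_neg]
      linarith

/-- The norm is a mixed Lipschitz function of one variable, so it has an exponential moment and
hence all power moments. -/
lemma Poincare.lintegral_enorm_rpow_ne_top (hM : 0 < M) (hP : Poincare M μ) {p : ℝ} (hp : 0 ≤ p) :
    ∫⁻ x, ‖x‖ₑ ^ p ∂μ ≠ ∞ := by
  have hF : MixedLipschitz 1 1 fun x : Fin 1 → EuclideanSpace ℝ (Fin d) => ‖x 0‖ := by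
    refine ⟨fun x y => ?_, fun i x z w => ?_⟩
    · simpa using abs_norm_sub_norm_le (x 0) (y 0)
    · obtain rfl : i = 0 := Subsingleton.elim _ _
      simpa using abs_norm_sub_norm_le z w
  obtain ⟨s, hs, hs1⟩ := exists_pos_mul_sq_le hM 1
  have h1 := hF.integrable_exp_abs hM hP zero_le_one zero_le_one hs hs1
  have h2 : Integrable (fun z => Real.exp (s * ‖z‖)) μ := by
    have := (measurePreserving_eval (fun _ : Fin 1 => μ) 0).integrable_comp
      (g := fun z => Real.exp (s * ‖z‖)) (by fun_prop)
    rw [← this]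
    simpa [Function.comp_def] using h1
  have h3 : Integrable (fun z => Real.exp (-s * ‖z‖)) μ :=
    integrable_of_abs_le (by fun_prop) (R := 1) fun z => by
      rw [Real.abs_exp, Real.exp_le_one_iff, neg_mul, neg_nonpos]; positivity
  have h4 := integrable_rpow_abs_of_integrable_exp_mul hs.ne' h2 h3 hp
  have h5 := h4.2
  rw [hasFiniteIntegral_iff_enorm] at h5
  refine ne_of_lt (lt_of_le_of_lt (lintegral_mono fun x => ?_) h5)
  rw [abs_norm, Real.enorm_of_nonneg (by positivity), ← ENNReal.ofReal_rpow_of_nonneg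
    (norm_nonneg _) hp, ofReal_norm]

end Concentration

end ProjOT

/-! ### Couplings and the triangle inequality for the Wasserstein distance. -/

namespace ProjOT

section Wasserstein

variable {m : ℕ} {p : ℝ} {μ ν ρ : Measure (EuclideanSpace ℝ (Fin m))}

lemma wasserstein_le_of_coupling (hp : 0 ≤ p)
    {π : Measure (EuclideanSpace ℝ (Fin m) × EuclideanSpace ℝ (Fin m))}
    (h1 : π.map Prod.fst = μ) (h2 : π.map Prod.snd = ν) :
    wasserstein p μ ν ≤ (∫⁻ z, ‖z.1 - z.2‖ₑ ^ p ∂π) ^ (1 / p) :=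
  ENNReal.rpow_le_rpow (iInf₂_le π ⟨h1, h2⟩) (by positivity)

lemma le_wasserstein (hp : 0 < p) {a : ℝ≥0∞}
    (h : ∀ π : Measure (EuclideanSpace ℝ (Fin m) × EuclideanSpace ℝ (Fin m)),
      π.map Prod.fst = μ → π.map Prod.snd = ν → a ≤ (∫⁻ z, ‖z.1 - z.2‖ₑ ^ p ∂π) ^ (1 / p)) :
    a ≤ wasserstein p μ ν := by
  rw [wasserstein, one_div, ENNReal.le_rpow_inv_iff hp]
  refine le_iInf₂ fun π hπ => ?_
  have := h π hπ.1 hπ.2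
  rwa [one_div, ENNReal.le_rpow_inv_iff hp] at this

/-- Triangle inequality, for a given coupling on one side. -/
lemma wasserstein_le_add [IsProbabilityMeasure μ] [IsProbabilityMeasure ρ] (hp : 1 ≤ p)
    {π : Measure (EuclideanSpace ℝ (Fin m) × EuclideanSpace ℝ (Fin m))}
    (h1 : π.map Prod.fst = μ) (h2 : π.map Prod.snd = ρ) :
    wasserstein p μ ν ≤ (∫⁻ z, ‖z.1 - z.2‖ₑ ^ p ∂π) ^ (1 / p) + wasserstein p ρ ν := by
  -- The first term is moved to the left so that the infimum defining the remaining distance can be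
  -- tested on one coupling `π'` at a time.
  rw [← tsub_le_iff_left]
  refine le_wasserstein (by linarith) fun π' h1' h2' => ?_
  rw [tsub_le_iff_left]
  have : IsProbabilityMeasure π := by
    have : IsProbabilityMeasure (π.map Prod.fst) := h1 ▸ inferInstance
    exact Measure.isProbabilityMeasure_of_map Prod.fst
  have : IsProbabilityMeasure π' := by
    have : IsProbabilityMeasure (π'.map Prod.fst) := h1' ▸ inferInstance
    exact Measure.isProbabilityMeasure_of_map Prod.fst
  -- Gluing: `θ` draws a pair from `π`, then a third point from the conditional law under `π'` given
  -- the second. Its outer marginal couples `μ` and `ν`, and Minkowski's inequality in `L^p(θ)`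
  -- concludes.
  set κ := π'.condKernel.comap (Prod.snd :
    EuclideanSpace ℝ (Fin m) × EuclideanSpace ℝ (Fin m) → EuclideanSpace ℝ (Fin m)) measurable_snd
    with hκ
  set θ := π ⊗ₘ κ with hθ
  have hfst : θ.map Prod.fst = π := Measure.fst_compProd π κ
  have hsnd : θ.map (fun q => (q.1.2, q.2)) = π' := by
    refine Measure.ext_of_lintegral _ fun f hf => ?_
    rw [lintegral_map hf (by fun_prop), hθ, Measure.lintegral_compProd (by fun_prop)]
    conv_rhs => rw [← Measure.disintegrate π' π'.condKernel, Measure.lintegral_compProd hf]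
    have e : π'.fst = π.map Prod.snd := h1'.trans h2.symm
    rw [e, lintegral_map (hf.lintegral_kernel_prod_right') measurable_snd]
    rfl
  have hc1 : (θ.map fun q => (q.1.1, q.2)).map Prod.fst = μ := by
    rw [Measure.map_map (by fun_prop) (by fun_prop), ← h1, ← hfst,
      Measure.map_map (by fun_prop) (by fun_prop)]
    rfl
  have hc2 : (θ.map fun q => (q.1.1, q.2)).map Prod.snd = ν := by
    rw [Measure.map_map (by fun_prop) (by fun_prop), ← h2', ← hsnd,
      Measure.map_map (by fun_prop) (by fun_prop)]
    rfl
  refine (wasserstein_le_of_coupling (by linarith) hc1 hc2).trans ?_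
  have hmeas : Measurable fun z : EuclideanSpace ℝ (Fin m) × EuclideanSpace ℝ (Fin m) =>
      ‖z.1 - z.2‖ₑ ^ p := by fun_prop
  conv_rhs => rw [← hfst, ← hsnd]
  rw [lintegral_map hmeas (by fun_prop), lintegral_map hmeas (by fun_prop),
    lintegral_map hmeas (by fun_prop)]
  refine le_trans (ENNReal.rpow_le_rpow (lintegral_mono fun q => ?_) (by positivity))
    (ENNReal.lintegral_Lp_add_le (μ := θ) (f := fun q => ‖q.1.1 - q.1.2‖ₑ)
      (g := fun q => ‖q.1.2 - q.2‖ₑ) (by fun_prop) (by fun_prop) hp)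
  refine ENNReal.rpow_le_rpow ?_ (by linarith)
  calc ‖q.1.1 - q.2‖ₑ = ‖(q.1.1 - q.1.2) + (q.1.2 - q.2)‖ₑ := by rw [sub_add_sub_cancel]
    _ ≤ _ := enorm_add_le _ _

end Wasserstein

lemma lintegral_empirical {d n : ℕ} (x : Fin n → EuclideanSpace ℝ (Fin d))
    (f : EuclideanSpace ℝ (Fin d) → ℝ≥0∞) :
    ∫⁻ z, f z ∂empirical x = (n : ℝ≥0∞)⁻¹ * ∑ i, f (x i) := by
  simp [empirical, lintegral_smul_measure]

lemma isProbabilityMeasure_empirical {d n : ℕ} (hn : 1 ≤ n)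
    (x : Fin n → EuclideanSpace ℝ (Fin d)) : IsProbabilityMeasure (empirical x) := by
  refine ⟨?_⟩
  have h := lintegral_empirical x fun _ => 1
  simp only [lintegral_one, Finset.sum_const, Finset.card_univ, Fintype.card_fin, nsmul_eq_mul,
    mul_one] at h
  rw [h, ENNReal.inv_mul_cancel (by exact_mod_cast (by omega)) (ENNReal.natCast_ne_top n)]

/-! ### Projections contract transport costs. -/

section Projection

variable {d k n : ℕ} (E : Stiefel d k)

lemma continuous_proj : Continuous (proj E) := by
  unfold proj
  fun_prop

lemma proj_sub (x y : EuclideanSpace ℝ (Fin d)) : proj E (x - y) = proj E x - proj E y := by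
  simp [proj, Matrix.mulVec_sub]

/-- As `EᵀE = 1`, the squared norm of `x - E Eᵀ x` equals `‖x‖² - ‖Eᵀ x‖²`. -/
lemma norm_proj_le (x : EuclideanSpace ℝ (Fin d)) : ‖proj E x‖ ≤ ‖x‖ := by
  have hsq : ∀ {m : ℕ} (v : EuclideanSpace ℝ (Fin m)), ‖v‖ ^ 2 = v.ofLp ⬝ᵥ v.ofLp := fun v => by
    rw [EuclideanSpace.real_norm_sq_eq]; simp [dotProduct, sq]
  refine (sq_le_sq₀ (norm_nonneg _) (norm_nonneg _)).1 ?_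
  rw [hsq, hsq]
  set v := x.ofLp with hv
  set w := E.1ᵀ *ᵥ v with hw
  show w ⬝ᵥ w ≤ v ⬝ᵥ v
  have h1 : v ⬝ᵥ (E.1 *ᵥ w) = w ⬝ᵥ w := by
    rw [Matrix.dotProduct_mulVec, ← Matrix.mulVec_transpose]
  have h2 : (E.1 *ᵥ w) ⬝ᵥ (E.1 *ᵥ w) = w ⬝ᵥ w := by
    rw [Matrix.dotProduct_mulVec, ← Matrix.mulVec_transpose, Matrix.mulVec_mulVec, E.2,
      Matrix.one_mulVec]
  have h3 : 0 ≤ (v - E.1 *ᵥ w) ⬝ᵥ (v - E.1 *ᵥ w) :=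
    Finset.sum_nonneg fun i _ => mul_self_nonneg _
  rw [sub_dotProduct, dotProduct_sub, dotProduct_sub, h2, dotProduct_comm (E.1 *ᵥ w) v, h1] at h3
  linarith

lemma enorm_proj_sub_le (x y : EuclideanSpace ℝ (Fin d)) : ‖proj E x - proj E y‖ₑ ≤ ‖x - y‖ₑ := by
  rw [← proj_sub, enorm_le_iff_norm_le]
  exact norm_proj_le E _

lemma isProbabilityMeasure_map_proj (μ : Measure (EuclideanSpace ℝ (Fin d)))
    [IsProbabilityMeasure μ] : IsProbabilityMeasure (μ.map (proj E)) :=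
  Measure.isProbabilityMeasure_map (continuous_proj E).measurable.aemeasurable

variable {p : ℝ} {μ ν ρ : Measure (EuclideanSpace ℝ (Fin d))}

lemma wasserstein_map_proj_le_add [IsProbabilityMeasure μ] [IsProbabilityMeasure ρ] (hp : 1 ≤ p)
    {π : Measure (EuclideanSpace ℝ (Fin d) × EuclideanSpace ℝ (Fin d))}
    (h1 : π.map Prod.fst = μ) (h2 : π.map Prod.snd = ρ) :
    wasserstein p (μ.map (proj E)) (ν.map (proj E)) ≤
      (∫⁻ z, ‖z.1 - z.2‖ₑ ^ p ∂π) ^ (1 / p) +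
        wasserstein p (ρ.map (proj E)) (ν.map (proj E)) := by
  have hm := (continuous_proj E).measurable
  have := isProbabilityMeasure_map_proj E μ
  have := isProbabilityMeasure_map_proj E ρ
  refine (wasserstein_le_add (π := π.map (Prod.map (proj E) (proj E))) hp ?_ ?_).trans
    (add_le_add_left ?_ _)
  · rw [Measure.map_map measurable_fst (hm.prodMap hm), ← h1, Measure.map_map hm measurable_fst]
    rfl
  · rw [Measure.map_map measurable_snd (hm.prodMap hm), ← h2, Measure.map_map hm measurable_snd]
    rfl
  · refine ENNReal.rpow_le_rpow ?_ (by positivity)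
    rw [lintegral_map (by fun_prop) (hm.prodMap hm)]
    exact lintegral_mono fun z =>
      ENNReal.rpow_le_rpow (enorm_proj_sub_le E _ _) (by linarith)

lemma wasserstein_map_proj_le_of_coupling (hp : 1 ≤ p)
    {π : Measure (EuclideanSpace ℝ (Fin d) × EuclideanSpace ℝ (Fin d))}
    (h1 : π.map Prod.fst = μ) (h2 : π.map Prod.snd = ν) :
    wasserstein p (μ.map (proj E)) (ν.map (proj E)) ≤
      (∫⁻ z, ‖z.1 - z.2‖ₑ ^ p ∂π) ^ (1 / p) := by
  have hm := (continuous_proj E).measurable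
  refine (wasserstein_le_of_coupling (π := π.map (Prod.map (proj E) (proj E)))
    (by linarith) ?_ ?_).trans ?_
  · rw [Measure.map_map measurable_fst (hm.prodMap hm), ← h1, Measure.map_map hm measurable_fst]
    rfl
  · rw [Measure.map_map measurable_snd (hm.prodMap hm), ← h2, Measure.map_map hm measurable_snd]
    rfl
  · refine ENNReal.rpow_le_rpow ?_ (by positivity)
    rw [lintegral_map (by fun_prop) (hm.prodMap hm)]
    exact lintegral_mono fun z =>
      ENNReal.rpow_le_rpow (enorm_proj_sub_le E _ _) (by linarith)

/-- Pair the atoms `x i` and `y i` with mass `1 / n` each. -/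
lemma wasserstein_map_proj_empirical_le_add (hn : 1 ≤ n) (hp : 1 ≤ p)
    (x y : Fin n → EuclideanSpace ℝ (Fin d)) :
    wasserstein p ((empirical x).map (proj E)) (ν.map (proj E)) ≤
      ((n : ℝ≥0∞)⁻¹ * ∑ i, ‖x i - y i‖ₑ ^ p) ^ (1 / p) +
        wasserstein p ((empirical y).map (proj E)) (ν.map (proj E)) := by
  have := isProbabilityMeasure_empirical hn x
  have := isProbabilityMeasure_empirical hn y
  set π : Measure (EuclideanSpace ℝ (Fin d) × EuclideanSpace ℝ (Fin d)) :=
    (n : ℝ≥0∞)⁻¹ • ∑ i, Measure.dirac (x i, y i) with hπ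
  have hmap : ∀ f : EuclideanSpace ℝ (Fin d) × EuclideanSpace ℝ (Fin d) →
      EuclideanSpace ℝ (Fin d), Measurable f →
      π.map f = (n : ℝ≥0∞)⁻¹ • ∑ i, Measure.dirac (f (x i, y i)) := fun f hf => by
    rw [hπ, Measure.map_smul, Measure.map_finset_sum' hf.aemeasurable]
    simp_rw [Measure.map_dirac' hf]
  refine (wasserstein_map_proj_le_add E hp (μ := empirical x) (ρ := empirical y) (π := π)
    (hmap _ measurable_fst)
    (hmap _ measurable_snd)).trans_eq ?_
  congr 2
  rw [hπ, lintegral_smul_measure, lintegral_finsetSum_measure]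
  simp_rw [lintegral_dirac' _ (by fun_prop : Measurable fun z : EuclideanSpace ℝ (Fin d) ×
    EuclideanSpace ℝ (Fin d) => ‖z.1 - z.2‖ₑ ^ p)]
  rfl

/-- A bound on the distance between projections that is uniform in the projection. -/
lemma exists_wasserstein_map_proj_empirical_le [IsProbabilityMeasure ν] (hn : 1 ≤ n) (hp : 1 ≤ p)
    (hν : ∫⁻ z, ‖z‖ₑ ^ p ∂ν ≠ ∞) (x : Fin n → EuclideanSpace ℝ (Fin d)) :
    ∃ B : ℝ≥0∞, B ≠ ∞ ∧ ∀ E : Stiefel d k,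
      wasserstein p ((empirical x).map (proj E)) (ν.map (proj E)) ≤ B := by
  have := isProbabilityMeasure_empirical hn x
  -- The cost of the independent coupling, which does not involve `E`.
  refine ⟨(∫⁻ z, ‖z.1 - z.2‖ₑ ^ p ∂(empirical x).prod ν) ^ (1 / p),
    ENNReal.rpow_ne_top_of_nonneg (by positivity) ?_, fun E =>
    wasserstein_map_proj_le_of_coupling E hp Measure.fst_prod Measure.snd_prod⟩
  have hx : ∫⁻ z, ‖z‖ₑ ^ p ∂empirical x ≠ ∞ := by
    rw [lintegral_empirical]
    refine ENNReal.mul_ne_top (ENNReal.inv_ne_top.2 (by exact_mod_cast (by omega))) ?_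
    exact ENNReal.sum_ne_top.2 fun i _ => ENNReal.rpow_ne_top_of_nonneg (by linarith) enorm_ne_top
  have h1 : ∫⁻ z, ‖z.1‖ₑ ^ p ∂(empirical x).prod ν ≠ ∞ := by
    rwa [← lintegral_map (f := fun z => ‖z‖ₑ ^ p) (by fun_prop) measurable_fst,
      show ((empirical x).prod ν).map Prod.fst = _ from Measure.fst_prod]
  have h2 : ∫⁻ z, ‖z.2‖ₑ ^ p ∂(empirical x).prod ν ≠ ∞ := by
    rwa [← lintegral_map (f := fun z => ‖z‖ₑ ^ p) (by fun_prop) measurable_snd,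
      show ((empirical x).prod ν).map Prod.snd = _ from Measure.snd_prod]
  refine ne_of_lt (lt_of_le_of_lt (lintegral_mono
    (g := fun z => (2 : ℝ≥0∞) ^ (p - 1) * (‖z.1‖ₑ ^ p + ‖z.2‖ₑ ^ p)) fun z => ?_) ?_)
  · exact (ENNReal.rpow_le_rpow enorm_sub_le (by linarith)).trans
      (ENNReal.rpow_add_le_mul_rpow_add_rpow _ _ hp)
  · rw [lintegral_const_mul _ (by fun_prop), lintegral_add_left (by fun_prop)]
    exact ENNReal.mul_lt_top (ENNReal.rpow_lt_top_of_nonneg (by linarith) (by simp))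
      (ENNReal.add_lt_top.2 ⟨h1.lt_top, h2.lt_top⟩)

end Projection

/-- Minkowski's inequality for a constant and a function that need not be measurable. -/
lemma lintegral_rpow_le_const_add {X : Type*} [MeasurableSpace X] {σ : Measure X}
    [IsProbabilityMeasure σ] {f g : X → ℝ≥0∞} {δ : ℝ≥0∞} {p : ℝ} (hp : 1 ≤ p)
    (h : ∀ x, f x ≤ δ + g x) :
    (∫⁻ x, f x ^ p ∂σ) ^ (1 / p) ≤ δ + (∫⁻ x, g x ^ p ∂σ) ^ (1 / p) := by
  have hp0 : 0 < p := by linarith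
  -- The lower integral of `f ^ p` is attained by a measurable minorant `u`. Then `u ^ (1 / p) - δ`
  -- is measurable and below `g`, so the usual Minkowski inequality applies to it. Thus the
  -- measurability in `E` of the projected distance is never needed.
  obtain ⟨u, hum, huf, hu⟩ := exists_measurable_le_lintegral_eq (μ := σ) fun x => f x ^ p
  set v : X → ℝ≥0∞ := fun x => u x ^ p⁻¹ - δ with hv
  have hvm : Measurable v := (hum.pow_const _).sub_const δ
  have hvg : ∀ x, v x ≤ g x := fun x =>
    tsub_le_iff_left.2 (((ENNReal.rpow_inv_le_iff hp0).2 (huf x)).trans (h x))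
  have huv : ∀ x, u x ≤ (δ + v x) ^ p := fun x => by
    rw [← ENNReal.rpow_inv_le_iff hp0]
    exact le_add_tsub
  rw [hu]
  calc (∫⁻ x, u x ∂σ) ^ (1 / p) ≤ (∫⁻ x, ((fun _ => δ) + v : X → ℝ≥0∞) x ^ p ∂σ) ^ (1 / p) :=
        ENNReal.rpow_le_rpow (lintegral_mono huv) (by positivity)
    _ ≤ (∫⁻ _, δ ^ p ∂σ) ^ (1 / p) + (∫⁻ x, v x ^ p ∂σ) ^ (1 / p) :=
        ENNReal.lintegral_Lp_add_le aemeasurable_const hvm.aemeasurable hp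
    _ ≤ _ := by
        refine add_le_add ?_ (ENNReal.rpow_le_rpow (lintegral_mono fun x =>
          ENNReal.rpow_le_rpow (hvg x) hp0.le) (by positivity))
        rw [lintegral_const, measure_univ, mul_one, ← ENNReal.rpow_mul, mul_one_div,
          div_self hp0.ne', ENNReal.rpow_one]

/-! ### Stability and finiteness of both projected distances. -/

section Distances

variable {d k n : ℕ} {p : ℝ} {ν : Measure (EuclideanSpace ℝ (Fin d))}

lemma prw_empirical_le_add (hn : 1 ≤ n) (hp : 1 ≤ p) (x y : Fin n → EuclideanSpace ℝ (Fin d)) :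
    prw p k (empirical x) ν ≤
      ((n : ℝ≥0∞)⁻¹ * ∑ i, ‖x i - y i‖ₑ ^ p) ^ (1 / p) + prw p k (empirical y) ν :=
  iSup_le fun E => (wasserstein_map_proj_empirical_le_add E hn hp x y).trans
    (add_le_add_right (le_iSup (fun E : Stiefel d k =>
      wasserstein p ((empirical y).map (proj E)) (ν.map (proj E))) E) _)

lemma iprw_empirical_le_add (hkd : k ≤ d) (hn : 1 ≤ n) (hp : 1 ≤ p)
    (x y : Fin n → EuclideanSpace ℝ (Fin d)) :
    iprw p hkd (empirical x) ν ≤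
      ((n : ℝ≥0∞)⁻¹ * ∑ i, ‖x i - y i‖ₑ ^ p) ^ (1 / p) + iprw p hkd (empirical y) ν :=
  lintegral_rpow_le_const_add hp fun E => wasserstein_map_proj_empirical_le_add E hn hp x y

variable [IsProbabilityMeasure ν]

lemma prw_empirical_ne_top (hn : 1 ≤ n) (hp : 1 ≤ p) (hν : ∫⁻ z, ‖z‖ₑ ^ p ∂ν ≠ ∞)
    (x : Fin n → EuclideanSpace ℝ (Fin d)) : prw p k (empirical x) ν ≠ ∞ := by
  obtain ⟨B, hB, h⟩ := exists_wasserstein_map_proj_empirical_le (k := k) hn hp hν x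
  exact ne_top_of_le_ne_top hB (iSup_le h)

lemma iprw_empirical_ne_top (hkd : k ≤ d) (hn : 1 ≤ n) (hp : 1 ≤ p)
    (hν : ∫⁻ z, ‖z‖ₑ ^ p ∂ν ≠ ∞) (x : Fin n → EuclideanSpace ℝ (Fin d)) :
    iprw p hkd (empirical x) ν ≠ ∞ := by
  obtain ⟨B, hB, h⟩ := exists_wasserstein_map_proj_empirical_le (k := k) hn hp hν x
  refine ENNReal.rpow_ne_top_of_nonneg (by positivity) (ne_of_lt (lt_of_le_of_lt
    (lintegral_mono fun E => ENNReal.rpow_le_rpow (h E) (by linarith)) ?_))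
  rw [lintegral_const, measure_univ, mul_one]
  exact ENNReal.rpow_lt_top_of_nonneg (by linarith) hB

end Distances

/-! ### Lipschitz constants of the statistic. -/

section MixedLipschitz

variable {n : ℕ} {p : ℝ}

/-- For `p ≤ 2` power means increase with the exponent, giving `n ^ (-1/2)`. For `p ≥ 2` the `ℓ^p`
norm is at most the `ℓ²` norm, and only the normalisation `n ^ (-1/p)` remains. -/
lemma rpow_mean_le (hn : 1 ≤ n) (hp : 1 ≤ p) {a : Fin n → ℝ} (ha : ∀ i, 0 ≤ a i) :
    ((n : ℝ)⁻¹ * ∑ i, a i ^ p) ^ (1 / p) ≤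
      (n : ℝ) ^ (-(1 / max 2 p)) * √(∑ i, a i ^ 2) := by
  have hn0 : (0 : ℝ) < n := by exact_mod_cast hn
  have hp0 : 0 < p := by linarith
  have hS : 0 ≤ ∑ i, a i ^ 2 := Finset.sum_nonneg fun i _ => sq_nonneg _
  have hT : 0 ≤ ∑ i, a i ^ p := Finset.sum_nonneg fun i _ => Real.rpow_nonneg (ha i) _
  rw [Real.sqrt_eq_rpow]
  rcases le_total p 2 with h | h
  · rw [max_eq_left h]
    have hmean := Real.rpow_arith_mean_le_arith_mean_rpow Finset.univ (fun _ : Fin n => (n : ℝ)⁻¹)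
      (fun i => a i ^ p) (fun _ _ => by positivity) (by simp [hn0.ne'])
      (fun i _ => Real.rpow_nonneg (ha i) _) (p := 2 / p) ((one_le_div hp0).2 h)
    rw [← Finset.mul_sum, ← Finset.mul_sum] at hmean
    have e : ∀ i, (a i ^ p) ^ (2 / p) = a i ^ 2 := fun i => by
      rw [← Real.rpow_mul (ha i), mul_div_cancel₀ _ hp0.ne', Real.rpow_two]
    simp_rw [e] at hmean
    calc ((n : ℝ)⁻¹ * ∑ i, a i ^ p) ^ (1 / p)
        = (((n : ℝ)⁻¹ * ∑ i, a i ^ p) ^ (2 / p)) ^ (1 / 2 : ℝ) := by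
          rw [← Real.rpow_mul (by positivity)]; congr 1; field_simp
      _ ≤ ((n : ℝ)⁻¹ * ∑ i, a i ^ 2) ^ (1 / 2 : ℝ) :=
          Real.rpow_le_rpow (by positivity) hmean (by norm_num)
      _ = _ := by
          rw [Real.mul_rpow (by positivity) hS, Real.inv_rpow hn0.le, Real.rpow_neg hn0.le]
  · rw [max_eq_right h]
    have hsum : ∑ i, a i ^ p ≤ (∑ i, a i ^ 2) ^ (p / 2) := by
      have e2 : ∀ s : ℝ, 0 ≤ s → s * s ^ (p / 2 - 1) = s ^ (p / 2) := fun s hs => by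
        rw [← Real.rpow_one_add' hs (by linarith)]; congr 1; ring
      rw [← e2 _ hS, Finset.sum_mul]
      refine Finset.sum_le_sum fun i hi => ?_
      have e3 : a i ^ p = (a i ^ 2) ^ (p / 2) := by
        rw [← Real.rpow_two, ← Real.rpow_mul (ha i)]; congr 1; ring
      rw [e3, ← e2 _ (sq_nonneg _)]
      refine mul_le_mul_of_nonneg_left (Real.rpow_le_rpow (sq_nonneg _) ?_ (by linarith))
        (sq_nonneg _)
      exact Finset.single_le_sum (f := fun i => a i ^ 2) (fun i _ => sq_nonneg _) hi
    rw [Real.mul_rpow (by positivity) hT, Real.inv_rpow hn0.le, Real.rpow_neg hn0.le]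
    refine mul_le_mul_of_nonneg_left ?_ (by positivity)
    calc (∑ i, a i ^ p) ^ (1 / p) ≤ ((∑ i, a i ^ 2) ^ (p / 2)) ^ (1 / p) :=
          Real.rpow_le_rpow hT hsum (by positivity)
      _ = _ := by rw [← Real.rpow_mul hS]; congr 1; field_simp

/-- Functions that are Lipschitz for the `p`-th power mean. -/
lemma mixedLipschitz_of_rpow_mean {E : Type*} [NormedAddCommGroup E] (hn : 1 ≤ n) (hp : 1 ≤ p)
    {F : (Fin n → E) → ℝ}
    (hF : ∀ x y, |F x - F y| ≤ ((n : ℝ)⁻¹ * ∑ i, ‖x i - y i‖ ^ p) ^ (1 / p)) :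
    MixedLipschitz ((n : ℝ) ^ (-(1 / max 2 p))) ((n : ℝ) ^ (-(1 / p))) F := by
  have hn0 : (0 : ℝ) < n := by exact_mod_cast hn
  have hp0 : 0 < p := by linarith
  refine ⟨fun x y => (hF x y).trans (rpow_mean_le hn hp fun i => norm_nonneg _),
    fun i x z w => (hF _ _).trans_eq ?_⟩
  have : ∑ j, ‖Function.update x i z j - Function.update x i w j‖ ^ p = ‖z - w‖ ^ p := by
    rw [Finset.sum_eq_single i]
    · simp
    · intro j _ hj
      simp [hj, Real.zero_rpow hp0.ne']
    · simp
  rw [this, Real.mul_rpow (by positivity) (by positivity), Real.inv_rpow hn0.le,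
    Real.rpow_neg hn0.le, ← Real.rpow_mul (norm_nonneg _), mul_one_div, div_self hp0.ne',
    Real.rpow_one]

lemma mixedLipschitz_toReal {E : Type*} [NormedAddCommGroup E] (hn : 1 ≤ n) (hp : 1 ≤ p)
    {F : (Fin n → E) → ℝ≥0∞} (htop : ∀ x, F x ≠ ∞)
    (hF : ∀ x y, F x ≤ ((n : ℝ≥0∞)⁻¹ * ∑ i, ‖x i - y i‖ₑ ^ p) ^ (1 / p) + F y) :
    MixedLipschitz ((n : ℝ) ^ (-(1 / max 2 p))) ((n : ℝ) ^ (-(1 / p))) fun x => (F x).toReal := by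
  have hp0 : 0 ≤ p := by linarith
  have hreal : ∀ x y : Fin n → E, ((n : ℝ≥0∞)⁻¹ * ∑ i, ‖x i - y i‖ₑ ^ p) ^ (1 / p) =
      ENNReal.ofReal (((n : ℝ)⁻¹ * ∑ i, ‖x i - y i‖ ^ p) ^ (1 / p)) := fun x y => by
    have hn0 : (0 : ℝ) < n := by exact_mod_cast hn
    rw [← ENNReal.ofReal_rpow_of_nonneg (by positivity) (by positivity),
      ENNReal.ofReal_mul (by positivity), ENNReal.ofReal_inv_of_pos hn0, ENNReal.ofReal_natCast,
      ENNReal.ofReal_sum_of_nonneg fun i _ => by positivity]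
    simp_rw [← ENNReal.ofReal_rpow_of_nonneg (norm_nonneg _) hp0, ofReal_norm]
  have hle : ∀ x y, (F x).toReal ≤
      ((n : ℝ)⁻¹ * ∑ i, ‖x i - y i‖ ^ p) ^ (1 / p) + (F y).toReal := fun x y => by
    have h := hF x y
    rw [hreal] at h
    have h2 := ENNReal.toReal_mono (ENNReal.add_ne_top.2 ⟨ENNReal.ofReal_ne_top, htop y⟩) h
    rwa [ENNReal.toReal_add ENNReal.ofReal_ne_top (htop y),
      ENNReal.toReal_ofReal (by positivity)] at h2
  refine mixedLipschitz_of_rpow_mean hn hp fun x y => abs_sub_le_iff.2 ⟨?_, ?_⟩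
  · linarith [hle x y]
  · have := hle y x
    simp_rw [norm_sub_rev (y _)] at this
    linarith

end MixedLipschitz

end ProjOT

/-! ### The concentration theorem. -/

theorem mainTheorem6 (M : ℝ) (hM : 0 < M) :
    ∃ K : ℝ, 0 < K ∧
      ∀ (d k n : ℕ) (p : ℝ) (_ : 1 ≤ k) (hkd : k ≤ d) (_ : 1 ≤ n) (_ : 1 ≤ p)
        (μ : Measure (EuclideanSpace ℝ (Fin d))) (_ : IsProbabilityMeasure μ)
        (_ : ProjOT.Poincare M μ)
        (Ω : Type*) (_ : MeasurableSpace Ω) (P : Measure Ω) (_ : IsProbabilityMeasure P)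
        (X : Fin n → Ω → EuclideanSpace ℝ (Fin d))
        (_ : ∀ i, HasLaw (X i) μ P) (_ : iIndepFun X P)
        (W : Measure (EuclideanSpace ℝ (Fin d)) → Measure (EuclideanSpace ℝ (Fin d)) → ℝ≥0∞)
        (_ : W = ProjOT.iprw p hkd ∨ W = ProjOT.prw p k),
        (∀ ω, W (ProjOT.empirical fun i => X i ω) μ ≠ ∞) ∧
        Integrable (fun ω => (W (ProjOT.empirical fun i => X i ω) μ).toReal) P ∧
        ∀ t : ℝ,
          P.real {ω | t ≤ |(W (ProjOT.empirical fun i => X i ω) μ).toReal -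
              ∫ ω', (W (ProjOT.empirical fun i => X i ω') μ).toReal ∂P|} ≤
            2 * Real.exp (-(K⁻¹ * min ((n : ℝ) ^ (1 / p) * t)
              ((n : ℝ) ^ (2 / max 2 p) * t ^ 2))) := by
  refine ⟨ProjOT.concentrationConst M, ProjOT.concentrationConst_pos hM, ?_⟩
  intro d k n p hk hkd hn hp μ hμ hP Ω _ P hPr X hX hind W hW
  have hν := hP.lintegral_enorm_rpow_ne_top hM (p := p) (by linarith)
  have hn0 : (0 : ℝ) < n := by exact_mod_cast hn
  -- Finiteness holds for every sample, not only almost surely: an empirical measure has finite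
  -- support and `μ` has a finite `p`-th moment.
  have htop : ∀ x : Fin n → EuclideanSpace ℝ (Fin d), W (ProjOT.empirical x) μ ≠ ∞ := by
    rcases hW with rfl | rfl
    · exact ProjOT.iprw_empirical_ne_top hkd hn hp hν
    · exact ProjOT.prw_empirical_ne_top hn hp hν
  have hadd : ∀ x y : Fin n → EuclideanSpace ℝ (Fin d), W (ProjOT.empirical x) μ ≤
      ((n : ℝ≥0∞)⁻¹ * ∑ i, ‖x i - y i‖ₑ ^ p) ^ (1 / p) + W (ProjOT.empirical y) μ := by
    rcases hW with rfl | rfl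
    · exact ProjOT.iprw_empirical_le_add hkd hn hp
    · exact ProjOT.prw_empirical_le_add hn hp
  set α : ℝ := (n : ℝ) ^ (-(1 / max 2 p)) with hα
  set β : ℝ := (n : ℝ) ^ (-(1 / p)) with hβ
  have hα0 : 0 < α := Real.rpow_pos_of_pos hn0 _
  have hβ0 : 0 < β := Real.rpow_pos_of_pos hn0 _
  set F : (Fin n → EuclideanSpace ℝ (Fin d)) → ℝ :=
    fun x => (W (ProjOT.empirical x) μ).toReal with hF
  have hFL : ProjOT.MixedLipschitz α β F := ProjOT.mixedLipschitz_toReal hn hp htop hadd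
  have hFc : Continuous F := (hFL.lipschitzWith hα0.le).continuous
  set ρ := Measure.pi fun _ : Fin n => μ with hρ
  have hXm : AEMeasurable (fun ω i => X i ω) P :=
    aemeasurable_pi_lambda _ fun i => (hX i).aemeasurable
  -- Independence makes the law of the sample a product, so everything transfers to `ρ`.
  have hmap : P.map (fun ω i => X i ω) = ρ := by
    rw [(iIndepFun_iff_map_fun_eq_pi_map fun i => (hX i).aemeasurable).1 hind, hρ]
    simp_rw [(hX _).map_eq]
  have hint : ∫ ω, F (fun i => X i ω) ∂P = ∫ x, F x ∂ρ := by
    rw [← hmap, integral_map hXm hFc.aestronglyMeasurable]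
  refine ⟨fun ω => htop _, ?_, fun t => ?_⟩
  · have h := hFL.integrable hM hP hα0.le hβ0.le
    rw [← hρ, ← hmap] at h
    exact h.comp_aemeasurable hXm
  · have hset : MeasurableSet {x | t ≤ |F x - ∫ y, F y ∂ρ|} :=
      (isClosed_le continuous_const (hFc.sub continuous_const).abs).measurableSet
    have h := hFL.measureReal_abs_ge_le hM hP hα0 hβ0 t
    rw [← hρ] at h
    have e : P.real {ω | t ≤ |F (fun i => X i ω) - ∫ ω', F (fun i => X i ω') ∂P|} =
        ρ.real {x | t ≤ |F x - ∫ y, F y ∂ρ|} := by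
      rw [hint, Measure.real, Measure.real]
      conv_rhs => rw [← hmap, Measure.map_apply_of_aemeasurable hXm (by rw [hmap]; exact hset)]
      rw [hmap]
      rfl
    have e1 : (n : ℝ) ^ (1 / p) * t = t / β := by
      rw [hβ, Real.rpow_neg hn0.le, div_inv_eq_mul, mul_comm]
    have e2 : (n : ℝ) ^ (2 / max 2 p) * t ^ 2 = t ^ 2 / α ^ 2 := by
      have h2 : α ^ 2 = ((n : ℝ) ^ (2 / max 2 p))⁻¹ := by
        rw [hα, Real.rpow_neg hn0.le, inv_pow, ← Real.rpow_mul_natCast hn0.le]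
        congr 2
        push_cast
        ring
      rw [h2, div_inv_eq_mul, mul_comm]
    rw [e1, e2]
    exact e.trans_le h
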